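/- Let $(M,g)$ be a finite-dimensional smooth Riemannian manifold (without boundary) with Levi-Civita connection $\nabla$ and curvature tensor $R(X,Y)Z=\nabla_X\nabla_YZ-\nabla_Y\nabla_XZ-\nabla_{[X,Y]}Z$, and let $f:M\to(0,\infty)$ be a smooth function. In the coordinates $(x^i,y^i)$ of $TM$ induced by a chart $(x^i)$ of $M$, the vertical and the horizontal lift of a vector field $X=X^i\frac{\partial}{\partial x^i}$ are $X^V=X^i\frac{\partial}{\partial y^i}$ and $X^H=X^i\big(\frac{\partial}{\partial x^i}-y^j\Gamma_{ij}^k\frac{\partial}{\partial y^k}\big)$, where $\Gamma_{ij}^k$ are the Christoffel symbols of $g$; tangent vectors of $M$ at $x$ are lifted to a point $(x,u)$ of $TM$ in the same way. The Mus-Gradient metric $g^f$ on $TM$ is the Riemannian metric given at $(x,u)\in TM$ by $$g^f(X^H,Y^H)=g_x(X,Y),\qquad g^f(X^H,Y^V)=0,\qquad g^f(X^V,Y^V)=g_x(X,Y)+X_x(f)Y_x(f).$$ Let $\nabla^f$ be the Levi-Civita connection of $(TM,g^f)$ and put $\alpha=1+g(\operatorname{grad}f,\operatorname{grad}f)$.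 Then, for all smooth vector fields $X,Y$ on $M$ and all $p=(x,u)\in TM$: 1. $(\nabla^{f}_{X^{H}}Y^{H})_{p}=(\nabla_{X}Y)^{H}_{p}-\frac12\big(R_{x}(X,Y)u\big)^{V}_p$; 2. $(\nabla^{f}_{X^{H}}Y^{V})_{p}=\frac12\big(R_{x}(u,Y)X\big)^{H}_p+\frac12Y_{x}(f)\big(R_{x}(u,\operatorname{grad}f)X\big)^{H}_p+\frac12Y_{x}(f)\big(\nabla_{X}\operatorname{grad}f\big)^{V}_{p}+(\nabla_{X}Y)^{V}_{p}+\frac{1}{2\alpha(x)}\big[g_{x}(Y,\nabla_{X}\operatorname{grad}f)-\frac12X_{x}(\alpha)Y_{x}(f)\big](\operatorname{grad}f)^{V}_{p}$; 3. $(\nabla^{f}_{X^{V}}Y^{H})_{p}=\frac12\big(R_{x}(u,X)Y\big)^{H}_p+\frac12X_{x}(f)\big(R_{x}(u,\operatorname{grad}f)Y\big)^{H}_p+\frac12X_{x}(f)\big(\nabla_{Y}\operatorname{grad}f\big)^{V}_{p}+\frac{1}{2\alpha(x)}\big[g_{x}(X,\nabla_{Y}\operatorname{grad}f)-\frac12Y_{x}(\alpha)X_{x}(f)\big](\operatorname{grad}f)^{V}_{p}$;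 4. $(\nabla^{f}_{X^{V}}Y^{V})_{p}=-\frac12X_{x}(f)\big(\nabla_{Y}\operatorname{grad}f\big)^{H}_{p}-\frac12Y_{x}(f)\big(\nabla_{X}\operatorname{grad}f\big)^{H}_{p}$. -/

import Mathlib

open Bundle
open scoped Manifold ContDiff

noncomputable section

namespace MusGradient

section LeviCivita

variable {E : Type*} [NormedAddCommGroup E] [NormedSpace ℝ E]
  {H : Type*} [TopologicalSpace H] {I : ModelWithCorners ℝ E H}
  {M : Type*} [TopologicalSpace M] [ChartedSpace H M] [IsManifold I 1 M]

/-- `cov` is a Levi-Civita connection of the metric `G` on the tangent bundle: it is torsion free,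
`∇_X Y - ∇_Y X = [X, Y]`, and metric, `v (G (Y, Z)) = G (∇_v Y, Z) + G (Y, ∇_v Z)`.
Recall that `cov Y x v` is `(∇_v Y)(x)`. The condition is on the values of `cov` at fields that are
differentiable at the point, and it determines these values. -/
structure IsLeviCivita (G : RiemannianMetric (fun x : M => TangentSpace I x))
    (cov : CovariantDerivative I E (fun x : M => TangentSpace I x)) : Prop where
  torsion_free : ∀ (X Y : Π x : M, TangentSpace I x) (x : M),
    MDifferentiableAt I I.tangent (fun y => (⟨y, X y⟩ : TangentBundle I M)) x →
    MDifferentiableAt I I.tangent (fun y => (⟨y, Y y⟩ : TangentBundle I M)) x →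
    cov Y x (X x) - cov X x (Y x) = VectorField.mlieBracket I X Y x
  metric : ∀ (Y Z : Π x : M, TangentSpace I x) (x : M) (v : TangentSpace I x),
    MDifferentiableAt I I.tangent (fun y => (⟨y, Y y⟩ : TangentBundle I M)) x →
    MDifferentiableAt I I.tangent (fun y => (⟨y, Z y⟩ : TangentBundle I M)) x →
    mvfderiv I (fun y => G.inner y (Y y) (Z y)) x v
      = G.inner x (cov Y x v) (Z x) + G.inner x (Y x) (cov Z x v)

/-- The vector field `∇_X Y`. -/
def nabla (cov : CovariantDerivative I E (fun x : M => TangentSpace I x))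
    (X Y : Π x : M, TangentSpace I x) (x : M) : TangentSpace I x :=
  cov Y x (X x)

/-- The function `X(h)`. -/
def lieDeriv (X : Π x : M, TangentSpace I x) (h : M → ℝ) (x : M) : ℝ :=
  mvfderiv I h x (X x)

/-- The curvature `R(A, B)C = ∇_A ∇_B C - ∇_B ∇_A C - ∇_[A, B] C` of a connection, on vector
fields. -/
def curvatureField (cov : CovariantDerivative I E (fun x : M => TangentSpace I x))
    (A B C : Π x : M, TangentSpace I x) (x : M) : TangentSpace I x :=
  nabla cov A (nabla cov B C) x - nabla cov B (nabla cov A C) x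
    - nabla cov (VectorField.mlieBracket I A B) C x

/-- The curvature tensor `R_x(a, b)c` at a point, computed on the extensions of the three tangent
vectors with constant components in the chart at `x`. -/
def curvature (cov : CovariantDerivative I E (fun x : M => TangentSpace I x)) (x : M)
    (a b c : TangentSpace I x) : TangentSpace I x :=
  curvatureField cov (FiberBundle.extend E a) (FiberBundle.extend E b) (FiberBundle.extend E c) x

end LeviCivita

variable {E : Type*} [NormedAddCommGroup E] [NormedSpace ℝ E]
  {M : Type*} [TopologicalSpace M] [ChartedSpace E M] [IsManifold 𝓘(ℝ, E) ∞ M]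

/-- A smooth Riemannian metric on `M`. -/
abbrev SmoothMetric (E : Type*) [NormedAddCommGroup E] [NormedSpace ℝ E]
    (M : Type*) [TopologicalSpace M] [ChartedSpace E M] [IsManifold 𝓘(ℝ, E) ∞ M] :=
  ContMDiffRiemannianMetric 𝓘(ℝ, E) ∞ E (fun x : M => TangentSpace 𝓘(ℝ, E) x)

/-- Connections on `M`. -/
abbrev Connection (E : Type*) [NormedAddCommGroup E] [NormedSpace ℝ E]
    (M : Type*) [TopologicalSpace M] [ChartedSpace E M] [IsManifold 𝓘(ℝ, E) ∞ M] :=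
  CovariantDerivative 𝓘(ℝ, E) E (fun x : M => TangentSpace 𝓘(ℝ, E) x)

/-- Connections on the manifold `TM`. -/
abbrev ConnectionTM (E : Type*) [NormedAddCommGroup E] [NormedSpace ℝ E]
    (M : Type*) [TopologicalSpace M] [ChartedSpace E M] [IsManifold 𝓘(ℝ, E) ∞ M] :=
  CovariantDerivative 𝓘(ℝ, E).tangent (E × E)
    (fun p : TangentBundle 𝓘(ℝ, E) M => TangentSpace 𝓘(ℝ, E).tangent p)

/-! ### The splitting of `T_p TM`

The tangent space of `TM` at `p = (x, u)` is `E × E`: a pair `(a, b)` stands for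
`a^i ∂/∂x^i + b^k ∂/∂y^k` in the chart of `TM` that is induced by the chart of `M` at `x`. In this
chart `∇_a U = a^i u^j Γ_ij^k ∂_k` at `x`, where `U` is the extension of `u` with constant
components. -/

/-- The differential at `p = (x, u)` of the projection `TM → M`. -/
def projection (p : TangentBundle 𝓘(ℝ, E) M) :
    TangentSpace 𝓘(ℝ, E).tangent p →L[ℝ] TangentSpace 𝓘(ℝ, E) p.1 :=
  ContinuousLinearMap.fst ℝ E E

/-- The fibre components `b^k` of a tangent vector of `TM`, in the chart induced by the chart at
the base point. -/
def fibreComponent (p : TangentBundle 𝓘(ℝ, E) M) :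
    TangentSpace 𝓘(ℝ, E).tangent p →L[ℝ] TangentSpace 𝓘(ℝ, E) p.1 :=
  ContinuousLinearMap.snd ℝ E E

/-- The vector `(a, b)` of `T_p TM`. -/
def mkTM (p : TangentBundle 𝓘(ℝ, E) M) (a b : TangentSpace 𝓘(ℝ, E) p.1) :
    TangentSpace 𝓘(ℝ, E).tangent p :=
  ((a, b) : E × E)

/-- The bilinear expression `a^i u^j Γ_ij^k` at `p = (x, u)`, as a linear map of `a`. -/
def christoffel (cov : Connection E M) (p : TangentBundle 𝓘(ℝ, E) M) :
    TangentSpace 𝓘(ℝ, E) p.1 →L[ℝ] TangentSpace 𝓘(ℝ, E) p.1 :=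
  cov (FiberBundle.extend E p.2) p.1

/-- The vertical lift `w^k ∂/∂y^k` to `p = (x, u)` of a tangent vector `w` at `x`. -/
def verticalLift (p : TangentBundle 𝓘(ℝ, E) M) (w : TangentSpace 𝓘(ℝ, E) p.1) :
    TangentSpace 𝓘(ℝ, E).tangent p :=
  mkTM p 0 w

/-- The horizontal lift `v^i (∂/∂x^i - u^j Γ_ij^k ∂/∂y^k)` to `p = (x, u)` of a tangent vector `v`
at `x`. -/
def horizontalLift (cov : Connection E M) (p : TangentBundle 𝓘(ℝ, E) M)
    (v : TangentSpace 𝓘(ℝ, E) p.1) : TangentSpace 𝓘(ℝ, E).tangent p :=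
  mkTM p v (-christoffel cov p v)

/-- The vertical lift `X^V` of a vector field. -/
def verticalField (X : Π x : M, TangentSpace 𝓘(ℝ, E) x) (p : TangentBundle 𝓘(ℝ, E) M) :
    TangentSpace 𝓘(ℝ, E).tangent p :=
  verticalLift p (X p.1)

/-- The horizontal lift `X^H` of a vector field. -/
def horizontalField (cov : Connection E M) (X : Π x : M, TangentSpace 𝓘(ℝ, E) x)
    (p : TangentBundle 𝓘(ℝ, E) M) : TangentSpace 𝓘(ℝ, E).tangent p :=
  horizontalLift cov p (X p.1)

/-- The vertical part `w` in the decomposition `ξ = v^H + w^V` of a tangent vector of `TM`. The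
horizontal part `v` is `projection p ξ`. -/
def verticalPart (cov : Connection E M) (p : TangentBundle 𝓘(ℝ, E) M) :
    TangentSpace 𝓘(ℝ, E).tangent p →L[ℝ] TangentSpace 𝓘(ℝ, E) p.1 :=
  fibreComponent p + (christoffel cov p).comp (projection p)

@[simp] lemma projection_mkTM (p : TangentBundle 𝓘(ℝ, E) M) (a b : TangentSpace 𝓘(ℝ, E) p.1) :
    projection p (mkTM p a b) = a := rfl

@[simp] lemma fibreComponent_mkTM (p : TangentBundle 𝓘(ℝ, E) M)
    (a b : TangentSpace 𝓘(ℝ, E) p.1) : fibreComponent p (mkTM p a b) = b := rfl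

@[simp] lemma projection_verticalLift (p : TangentBundle 𝓘(ℝ, E) M)
    (w : TangentSpace 𝓘(ℝ, E) p.1) : projection p (verticalLift p w) = 0 := rfl

@[simp] lemma projection_horizontalLift (cov : Connection E M) (p : TangentBundle 𝓘(ℝ, E) M)
    (v : TangentSpace 𝓘(ℝ, E) p.1) : projection p (horizontalLift cov p v) = v := rfl

@[simp] lemma verticalPart_verticalLift (cov : Connection E M) (p : TangentBundle 𝓘(ℝ, E) M)
    (w : TangentSpace 𝓘(ℝ, E) p.1) : verticalPart cov p (verticalLift p w) = w := by
  simp [verticalPart, verticalLift]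

@[simp] lemma verticalPart_horizontalLift (cov : Connection E M) (p : TangentBundle 𝓘(ℝ, E) M)
    (v : TangentSpace 𝓘(ℝ, E) p.1) : verticalPart cov p (horizontalLift cov p v) = 0 := by
  simp [verticalPart, horizontalLift]

/-- A tangent vector of `TM` whose horizontal and vertical parts vanish is zero. -/
lemma eq_zero_of_parts (cov : Connection E M) (p : TangentBundle 𝓘(ℝ, E) M)
    (ξ : TangentSpace 𝓘(ℝ, E).tangent p) (h₁ : projection p ξ = 0)
    (h₂ : verticalPart cov p ξ = 0) : ξ = 0 := by
  have h₃ : fibreComponent p ξ = 0 := by simpa [verticalPart, h₁] using h₂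
  exact Prod.ext (show (ξ : E × E).1 = 0 from h₁) (show (ξ : E × E).2 = 0 from h₃)

/-! ### The gradient and the metric on `TM` -/

instance [FiniteDimensional ℝ E] (x : M) : FiniteDimensional ℝ (TangentSpace 𝓘(ℝ, E) x) :=
  inferInstanceAs (FiniteDimensional ℝ E)

/-- A metric, as a map from the tangent space to its dual. -/
def flat (g : SmoothMetric E M) (x : M) :
    TangentSpace 𝓘(ℝ, E) x →ₗ[ℝ] Module.Dual ℝ (TangentSpace 𝓘(ℝ, E) x) where
  toFun v := (g.inner x v).toLinearMap
  map_add' v w := by ext; simp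
  map_smul' c v := by ext; simp

lemma flat_injective (g : SmoothMetric E M) (x : M) : Function.Injective (flat g x) := by
  rw [injective_iff_map_eq_zero]
  intro v hv
  by_contra hne
  have h := g.pos x v hne
  have h' : g.inner x v v = 0 := congrArg (fun l => l v) hv
  exact h.ne' h'

lemma inner_self_nonneg (g : SmoothMetric E M) (x : M) (v : TangentSpace 𝓘(ℝ, E) x) :
    0 ≤ g.inner x v v := by
  by_cases h : v = 0
  · simp [h]
  · exact (g.pos x v h).le

/-- The gradient of `f`: the vector field with `g (grad f, v) = df (v)`. -/
def grad [FiniteDimensional ℝ E] (g : SmoothMetric E M) (f : M → ℝ) (x : M) : TangentSpace 𝓘(ℝ, E) x :=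
  ((flat g x).linearEquivOfInjective (flat_injective g x) Subspace.dual_finrank_eq.symm).symm
    (mvfderiv 𝓘(ℝ, E) f x).toLinearMap

lemma inner_grad [FiniteDimensional ℝ E] (g : SmoothMetric E M) (f : M → ℝ) (x : M) (v : TangentSpace 𝓘(ℝ, E) x) :
    g.inner x (grad g f x) v = mvfderiv 𝓘(ℝ, E) f x v := by
  have h := ((flat g x).linearEquivOfInjective (flat_injective g x)
    Subspace.dual_finrank_eq.symm).apply_symm_apply (mvfderiv 𝓘(ℝ, E) f x).toLinearMap
  exact congrArg (fun l : Module.Dual ℝ (TangentSpace 𝓘(ℝ, E) x) => l v) h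

/-- The function `α = 1 + ‖grad f‖²`. -/
def alpha [FiniteDimensional ℝ E] (g : SmoothMetric E M) (f : M → ℝ) (x : M) : ℝ :=
  1 + g.inner x (grad g f x) (grad g f x)

/-- The bilinear form `g (dπ ξ, dπ η) + g (K ξ, K η) + df (K ξ) df (K η)` on `T_p TM`, where `dπ` is
the horizontal part and `K` the vertical part. -/
def musGradientForm (g : SmoothMetric E M) (f : M → ℝ) (cov : Connection E M)
    (p : TangentBundle 𝓘(ℝ, E) M) :
    TangentSpace 𝓘(ℝ, E).tangent p →L[ℝ] TangentSpace 𝓘(ℝ, E).tangent p →L[ℝ] ℝ :=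
  let B : E →L[ℝ] E →L[ℝ] ℝ := g.inner p.1
  let P : E × E →L[ℝ] E := projection p
  let K : E × E →L[ℝ] E := verticalPart cov p
  let d : E →L[ℝ] ℝ := mvfderiv 𝓘(ℝ, E) f p.1
  (B.bilinearComp P P + B.bilinearComp K K + (d.comp K).smulRight (d.comp K) :
    E × E →L[ℝ] E × E →L[ℝ] ℝ)

lemma musGradientForm_apply (g : SmoothMetric E M) (f : M → ℝ) (cov : Connection E M)
    (p : TangentBundle 𝓘(ℝ, E) M) (ξ η : TangentSpace 𝓘(ℝ, E).tangent p) :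
    musGradientForm g f cov p ξ η
      = g.inner p.1 (projection p ξ) (projection p η)
        + g.inner p.1 (verticalPart cov p ξ) (verticalPart cov p η)
        + mvfderiv 𝓘(ℝ, E) f p.1 (verticalPart cov p ξ)
          * mvfderiv 𝓘(ℝ, E) f p.1 (verticalPart cov p η) := rfl

lemma musGradientForm_pos (g : SmoothMetric E M) (f : M → ℝ) (cov : Connection E M)
    (p : TangentBundle 𝓘(ℝ, E) M) (ξ : TangentSpace 𝓘(ℝ, E).tangent p) (hξ : ξ ≠ 0) :
    0 < musGradientForm g f cov p ξ ξ := by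
  rw [musGradientForm_apply]
  have h₁ := inner_self_nonneg g p.1 (projection p ξ)
  have h₂ := inner_self_nonneg g p.1 (verticalPart cov p ξ)
  have h₃ := mul_self_nonneg (mvfderiv 𝓘(ℝ, E) f p.1 (verticalPart cov p ξ))
  by_cases h : projection p ξ = 0
  · have h' : verticalPart cov p ξ ≠ 0 := fun h' => hξ (eq_zero_of_parts cov p ξ h h')
    have := g.pos p.1 _ h'
    linarith
  · have := g.pos p.1 _ h
    linarith

/-- The unit ball of a positive definite form on a finite-dimensional space is bounded. -/
lemma isVonNBounded_of_pos {V : Type*} [NormedAddCommGroup V] [NormedSpace ℝ V]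
    [FiniteDimensional ℝ V] (B : V →L[ℝ] V →L[ℝ] ℝ) (hB : ∀ v, v ≠ 0 → 0 < B v v) :
    Bornology.IsVonNBounded ℝ {v : V | B v v < 1} := by
  rw [NormedSpace.isVonNBounded_iff, isBounded_iff_forall_norm_le]
  rcases subsingleton_or_nontrivial V with hV | hV
  · exact ⟨0, fun v _ => by simp [Subsingleton.elim v 0]⟩
  obtain ⟨e, he⟩ : (Metric.sphere (0 : V) 1).Nonempty :=
    NormedSpace.sphere_nonempty.mpr zero_le_one
  have hcont : Continuous fun v : V => B v v := by fun_prop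
  obtain ⟨w, hw, hmin⟩ :=
    (isCompact_sphere (0 : V) 1).exists_isMinOn ⟨e, he⟩ hcont.continuousOn
  have hw0 : w ≠ 0 := by
    rintro rfl
    simp at hw
  have hm := hB w hw0
  refine ⟨1 + 1 / B w w, fun v hv => ?_⟩
  rcases eq_or_ne v 0 with rfl | hv0
  · simp only [norm_zero]
    positivity
  have hn : 0 < ‖v‖ := norm_pos_iff.mpr hv0
  have hu : (‖v‖⁻¹ • v) ∈ Metric.sphere (0 : V) 1 := by
    simp [norm_smul, hn.ne']
  have h₁ : B w w ≤ B (‖v‖⁻¹ • v) (‖v‖⁻¹ • v) := hmin hu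
  have h₂ : B (‖v‖⁻¹ • v) (‖v‖⁻¹ • v) = ‖v‖⁻¹ * (‖v‖⁻¹ * B v v) := by simp
  have h₃ : B w w * ‖v‖ ^ 2 ≤ B v v := by
    calc B w w * ‖v‖ ^ 2 ≤ (‖v‖⁻¹ * (‖v‖⁻¹ * B v v)) * ‖v‖ ^ 2 := by
          rw [← h₂]; gcongr
      _ = B v v := by field_simp
  have h₄ : ‖v‖ ^ 2 ≤ 1 / B w w := by
    rw [le_div_iff₀ hm]
    have : B v v < 1 := hv
    linarith
  nlinarith [sq_nonneg (‖v‖ - 1)]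

variable [FiniteDimensional ℝ E]

/-- The Mus-Gradient metric `g^f` on `TM`, where `cov` is the Levi-Civita connection of `g`. -/
def musGradientMetric (g : SmoothMetric E M) (f : M → ℝ) (cov : Connection E M) :
    RiemannianMetric
      (fun p : TangentBundle 𝓘(ℝ, E) M => TangentSpace 𝓘(ℝ, E).tangent p) where
  inner := musGradientForm g f cov
  symm p ξ η := by
    rw [musGradientForm_apply, musGradientForm_apply, g.symm p.1 (projection p ξ),
      g.symm p.1 (verticalPart cov p ξ)]
    ring
  pos := musGradientForm_pos g f cov
  continuousAt p := by
    have h (B : E × E →L[ℝ] E × E →L[ℝ] ℝ) : Continuous fun ξ : E × E => B ξ ξ := by fun_prop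
    exact (h (musGradientForm g f cov p)).continuousAt
  isVonNBounded p :=
    isVonNBounded_of_pos (V := E × E) (musGradientForm g f cov p) (musGradientForm_pos g f cov p)

/-- `g^f (X^H, Y^H) = g (X, Y)`. -/
lemma musGradientMetric_horizontal_horizontal (g : SmoothMetric E M) (f : M → ℝ) (cov : Connection E M)
    (p : TangentBundle 𝓘(ℝ, E) M) (v w : TangentSpace 𝓘(ℝ, E) p.1) :
    (musGradientMetric g f cov).inner p (horizontalLift cov p v) (horizontalLift cov p w)
      = g.inner p.1 v w := by
  simp [musGradientMetric, musGradientForm_apply]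

/-- `g^f (X^H, Y^V) = 0`. -/
lemma musGradientMetric_horizontal_vertical (g : SmoothMetric E M) (f : M → ℝ) (cov : Connection E M)
    (p : TangentBundle 𝓘(ℝ, E) M) (v w : TangentSpace 𝓘(ℝ, E) p.1) :
    (musGradientMetric g f cov).inner p (horizontalLift cov p v) (verticalLift p w) = 0 := by
  simp [musGradientMetric, musGradientForm_apply]

/-- `g^f (X^V, Y^V) = g (X, Y) + X(f) Y(f)`. -/
lemma musGradientMetric_vertical_vertical (g : SmoothMetric E M) (f : M → ℝ) (cov : Connection E M)
    (p : TangentBundle 𝓘(ℝ, E) M) (v w : TangentSpace 𝓘(ℝ, E) p.1) :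
    (musGradientMetric g f cov).inner p (verticalLift p v) (verticalLift p w)
      = g.inner p.1 v w + mvfderiv 𝓘(ℝ, E) f p.1 v * mvfderiv 𝓘(ℝ, E) f p.1 w := by
  simp [musGradientMetric, musGradientForm_apply]

end MusGradient

end

open MusGradient

/-! The Levi-Civita connection of `g^f` is determined by the Koszul formula, so it suffices to pair
each covariant derivative of lifts with an arbitrary lift `Z^H` or `Z^V`. Pairing with `Z^H` sees
only the projection to `M`, through `g`. Pairing with `Z^V` sees only the vertical part, through the
positive definite form `F = g + df ⊗ df`.

Two facts make the Koszul formula explicit. The functions `g^f (lift, lift)` are constant on the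
fibres of `TM`, so their derivatives along vertical vectors vanish and those along horizontal
vectors are derivatives on `M`. The brackets are `[X^H, Y^H] = [X, Y]^H - (R(X, Y)u)^V`, `[X^H, Y^V]
= (∇_X Y)^V` and `[X^V, Y^V] = 0`.

The curvature terms come from the first bracket, and the pair symmetry `g(R(a, b)c, d) = g(R(c, d)a,
b)` (`curvature_pair_symm`) brings them to the stated form. All other terms in `f` come from `(∇_Z
F)(X, Y) = Hess f(Z, X) Y(f) + X(f) Hess f(Z, Y)` (`mvfderiv_fibreForm`). Solving for the vertical
part of `∇_{X^H} Y^V` requires inverting `F`. Since `F(grad f, ·) = α df` and `df(∇_X grad f) =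
X(α)/2`, one gets `g(∇_X grad f, ·) = F(∇_X grad f - (X(α)/2α) grad f, ·)`, which is the origin of
the coefficient of `(grad f)^V`. The mixed case `∇_{X^V} Y^H` then follows from vanishing torsion.

The brackets and the curvature symmetry are computed in charts. The main link is
`chartDeriv_horizontalLift`: the horizontal lift, defined at each point in the chart centred there,
has the usual coordinate expression in every fixed chart. -/

noncomputable section

set_option maxSynthPendingDepth 3

namespace MusGradient

/-! ### Functions, vector fields and Lie brackets in a fixed chart. -/

section ChartCoordinates

variable {E : Type*} [NormedAddCommGroup E] [NormedSpace ℝ E]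
  {H : Type*} [TopologicalSpace H] {I : ModelWithCorners ℝ E H}
  {M : Type*} [TopologicalSpace M] [ChartedSpace H M]

variable (I) in
/-- The differential at `y` of the preferred chart at `x₀`. -/
def chartDeriv [IsManifold I 1 M] (x₀ y : M) : TangentSpace I y →L[ℝ] E :=
  (trivializationAt E (TangentSpace I : M → Type _) x₀).continuousLinearMapAt ℝ y

variable (I) in
/-- The vector field with constant components `e` in the preferred chart at `x₀`. -/
def constField [IsManifold I 1 M] (x₀ : M) (e : E) (y : M) : TangentSpace I y :=
  (trivializationAt E (TangentSpace I : M → Type _) x₀).symmL ℝ y e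

variable (I) in
/-- The components of a vector field in the preferred chart at `x₀`, as functions on the model
space. -/
def localField [IsManifold I 1 M] (x₀ : M) (V : Π x : M, TangentSpace I x) (z : E) : E :=
  chartDeriv I x₀ ((extChartAt I x₀).symm z) (V ((extChartAt I x₀).symm z))

lemma chartDeriv_constField [IsManifold I 1 M] {x₀ y : M} (hy : y ∈ (chartAt H x₀).source)
    (e : E) : chartDeriv I x₀ y (constField I x₀ e y) = e :=
  (trivializationAt E (TangentSpace I : M → Type _) x₀).continuousLinearMapAt_symmL hy e

lemma constField_chartDeriv [IsManifold I 1 M] {x₀ y : M} (hy : y ∈ (chartAt H x₀).source)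
    (v : TangentSpace I y) : constField I x₀ (chartDeriv I x₀ y v) y = v :=
  (trivializationAt E (TangentSpace I : M → Type _) x₀).symmL_continuousLinearMapAt hy v

lemma chartDeriv_injective [IsManifold I 1 M] {x₀ y : M} (hy : y ∈ (chartAt H x₀).source) :
    Function.Injective (chartDeriv I x₀ y) := fun v w h => by
  rw [← constField_chartDeriv hy v, h, constField_chartDeriv hy]

/-- The tangent space at `x` is identified with `E` by the preferred chart at `x` itself, so no
coordinate change occurs at the centre. -/
lemma chartDeriv_self [IsManifold I 1 M] (x : M) (v : TangentSpace I x) :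
    chartDeriv I x x v = v := by
  rw [chartDeriv, TangentBundle.continuousLinearMapAt_trivializationAt (mem_chart_source H x),
    mfderiv_extChartAt_self]
  rfl

lemma chartDeriv_eq_mfderiv [IsManifold I 1 M] {x₀ y : M} (hy : y ∈ (chartAt H x₀).source) :
    chartDeriv I x₀ y = mfderiv I 𝓘(ℝ, E) (extChartAt I x₀) y :=
  TangentBundle.continuousLinearMapAt_trivializationAt hy

/-- This gives access in coordinates to `curvature` and `christoffel`, which are defined through
`FiberBundle.extend`. -/
lemma extend_eq_constField [IsManifold I 1 M] {x y : M} (hy : y ∈ (chartAt H x).source)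
    (v : TangentSpace I x) : FiberBundle.extend E v y = constField I x v y := by
  have h := chartDeriv_self (I := I) x v
  rw [chartDeriv, Trivialization.continuousLinearMapAt_apply,
    Trivialization.coe_linearMapAt_of_mem _ (mem_chart_source H x)] at h
  change (trivializationAt E (TangentSpace I : M → Type _) x).symm y
    (trivializationAt E (TangentSpace I : M → Type _) x ⟨x, v⟩).2 = _
  refine (congrArg (fun w : E => (trivializationAt E (TangentSpace I : M → Type _) x).symm y w)
    h).trans ?_
  exact ((trivializationAt E (TangentSpace I : M → Type _) x).symmL_apply hy v).symm

lemma symm_extChartAt_apply {x₀ y : M} (hy : y ∈ (chartAt H x₀).source) :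
    (extChartAt I x₀).symm (extChartAt I x₀ y) = y :=
  (extChartAt I x₀).left_inv (by rwa [extChartAt_source])

lemma localField_apply [IsManifold I 1 M] {x₀ y : M} (hy : y ∈ (chartAt H x₀).source)
    (V : Π x : M, TangentSpace I x) :
    localField I x₀ V (extChartAt I x₀ y) = chartDeriv I x₀ y (V y) := by
  rw [localField, symm_extChartAt_apply hy]

variable [I.Boundaryless]

lemma extChartAt_target_mem_nhds_apply {x₀ y : M} (hy : y ∈ (chartAt H x₀).source) :
    (extChartAt I x₀).target ∈ nhds (extChartAt I x₀ y) :=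
  (isOpen_extChartAt_target x₀).mem_nhds
    ((extChartAt I x₀).map_source (by rwa [extChartAt_source]))

omit [I.Boundaryless] in
lemma symm_mem_chart_source {x₀ : M} {z : E} (hz : z ∈ (extChartAt I x₀).target) :
    (extChartAt I x₀).symm z ∈ (chartAt H x₀).source := by
  rw [← extChartAt_source I]
  exact (extChartAt I x₀).map_target hz

lemma eventually_symm_mem {x₀ y : M} (hy : y ∈ (chartAt H x₀).source) :
    ∀ᶠ z in nhds (extChartAt I x₀ y), (extChartAt I x₀).symm z ∈ (chartAt H x₀).source ∧
      extChartAt I x₀ ((extChartAt I x₀).symm z) = z := by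
  filter_upwards [extChartAt_target_mem_nhds_apply hy] with z hz
  exact ⟨symm_mem_chart_source hz, (extChartAt I x₀).right_inv hz⟩

lemma eventually_mem_source {x₀ y : M} (hy : y ∈ (chartAt H x₀).source) :
    ∀ᶠ y' in nhds y, y' ∈ (chartAt H x₀).source :=
  (chartAt H x₀).open_source.mem_nhds hy

lemma contMDiffAt_symm {n : ℕ∞ω} [IsManifold I n M] {x₀ y : M}
    (hy : y ∈ (chartAt H x₀).source) :
    ContMDiffAt 𝓘(ℝ, E) I n (extChartAt I x₀).symm (extChartAt I x₀ y) :=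
  (contMDiffOn_extChartAt_symm x₀).contMDiffAt (extChartAt_target_mem_nhds_apply hy)

omit [I.Boundaryless] in
lemma contMDiffAt_chart {n : ℕ∞ω} [IsManifold I n M] {x₀ y : M}
    (hy : y ∈ (chartAt H x₀).source) :
    ContMDiffAt I 𝓘(ℝ, E) n (extChartAt I x₀) y :=
  contMDiffAt_extChartAt' hy

variable {F : Type*} [NormedAddCommGroup F] [NormedSpace ℝ F]

lemma mdifferentiableAt_iff_comp_symm [IsManifold I 1 M] {x₀ y : M}
    (hy : y ∈ (chartAt H x₀).source) {h : M → F} :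
    MDifferentiableAt I 𝓘(ℝ, F) h y
      ↔ DifferentiableAt ℝ (h ∘ (extChartAt I x₀).symm) (extChartAt I x₀ y) := by
  rw [← mdifferentiableAt_iff_differentiableAt]
  have hs : MDifferentiableAt 𝓘(ℝ, E) I (extChartAt I x₀).symm (extChartAt I x₀ y) :=
    (contMDiffAt_symm (n := 1) hy).mdifferentiableAt one_ne_zero
  have hc : MDifferentiableAt I 𝓘(ℝ, E) (extChartAt I x₀) y :=
    (contMDiffAt_chart (n := 1) hy).mdifferentiableAt one_ne_zero
  constructor
  · intro h'
    exact MDifferentiableAt.comp_of_eq (extChartAt I x₀ y) h' hs (symm_extChartAt_apply hy)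
  · intro h'
    refine (h'.comp y hc).congr_of_eventuallyEq ?_
    filter_upwards [eventually_mem_source hy] with y' hy'
    simp only [Function.comp_apply]
    rw [symm_extChartAt_apply hy']

lemma contDiffAt_comp_symm {n : ℕ∞ω} [IsManifold I n M] {x₀ y : M}
    (hy : y ∈ (chartAt H x₀).source) {h : M → F} (hh : ContMDiffAt I 𝓘(ℝ, F) n h y) :
    ContDiffAt ℝ n (h ∘ (extChartAt I x₀).symm) (extChartAt I x₀ y) := by
  rw [← contMDiffAt_iff_contDiffAt]
  exact ContMDiffAt.comp_of_eq hh (contMDiffAt_symm hy) (symm_extChartAt_apply hy)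

lemma mvfderiv_eq_fderiv [IsManifold I 1 M] {x₀ y : M} (hy : y ∈ (chartAt H x₀).source)
    {h : M → F} (hh : MDifferentiableAt I 𝓘(ℝ, F) h y) (v : TangentSpace I y) :
    mvfderiv I h y v
      = fderiv ℝ (h ∘ (extChartAt I x₀).symm) (extChartAt I x₀ y) (chartDeriv I x₀ y v) := by
  have hc : MDifferentiableAt I 𝓘(ℝ, E) (extChartAt I x₀) y :=
    (contMDiffAt_chart (n := 1) hy).mdifferentiableAt one_ne_zero
  have hd := (mdifferentiableAt_iff_comp_symm (I := I) hy).1 hh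
  have he : h =ᶠ[nhds y] (h ∘ (extChartAt I x₀).symm) ∘ extChartAt I x₀ := by
    filter_upwards [eventually_mem_source hy] with y' hy'
    simp only [Function.comp_apply]
    rw [symm_extChartAt_apply hy']
  have h1 : mfderiv I 𝓘(ℝ, F) h y
      = mfderiv I 𝓘(ℝ, F) ((h ∘ (extChartAt I x₀).symm) ∘ extChartAt I x₀) y := he.mfderiv_eq
  have h2 := mfderiv_comp y (mdifferentiableAt_iff_differentiableAt.2 hd) hc
  rw [mfderiv_eq_fderiv] at h2
  rw [chartDeriv_eq_mfderiv hy]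
  change (mfderiv I 𝓘(ℝ, F) h y : TangentSpace I y →L[ℝ] F) v = _
  rw [h1, h2]
  rfl

/-- A `C^2` manifold has a `C^1` tangent bundle, so its trivializations preserve differentiability
of sections. -/
lemma mdifferentiableAt_iff_localField [IsManifold I 2 M] {x₀ y : M}
    (hy : y ∈ (chartAt H x₀).source) {V : Π x : M, TangentSpace I x} :
    MDifferentiableAt I I.tangent (fun x => (⟨x, V x⟩ : TangentBundle I M)) y
      ↔ DifferentiableAt ℝ (localField I x₀ V) (extChartAt I x₀ y) := by
  have : IsManifold I (1 + 1) M := by rwa [one_add_one_eq_two]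
  have : IsManifold I 1 M := IsManifold.of_le (n := 2) (by norm_num)
  have : ContMDiffVectorBundle 1 E (TangentSpace I : M → Type _) I :=
    TangentBundle.contMDiffVectorBundle
  have h1 := (trivializationAt E (TangentSpace I : M → Type _) x₀).mdifferentiableAt_section_iff
    I V (b₀ := y) hy
  refine h1.trans (Iff.trans ?_ ((mdifferentiableAt_iff_comp_symm (I := I)
    (h := fun x => chartDeriv I x₀ x (V x)) hy)))
  refine Filter.EventuallyEq.mdifferentiableAt_iff ?_
  filter_upwards [eventually_mem_source hy] with y' hy'
  rw [chartDeriv, Trivialization.continuousLinearMapAt_apply,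
    Trivialization.coe_linearMapAt_of_mem _ hy']

lemma contDiffAt_localField [IsManifold I ∞ M] {x₀ y : M}
    (hy : y ∈ (chartAt H x₀).source) {V : Π x : M, TangentSpace I x}
    (hV : ContMDiffAt I I.tangent ∞ (fun x => (⟨x, V x⟩ : TangentBundle I M)) y) :
    ContDiffAt ℝ ∞ (localField I x₀ V) (extChartAt I x₀ y) := by
  have h1 := (trivializationAt E (TangentSpace I : M → Type _) x₀).contMDiffAt_section_iff
    (n := ∞) (IB := I) (s := V) (x₀ := y) hy
  refine contDiffAt_comp_symm (I := I) (h := fun x => chartDeriv I x₀ x (V x)) hy ?_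
  refine (h1.1 hV).congr_of_eventuallyEq ?_
  filter_upwards [eventually_mem_source hy] with y' hy'
  rw [chartDeriv, Trivialization.continuousLinearMapAt_apply,
    Trivialization.coe_linearMapAt_of_mem _ hy']

lemma localField_constField [IsManifold I 1 M] {x₀ y : M} (hy : y ∈ (chartAt H x₀).source)
    (e : E) : localField I x₀ (constField I x₀ e) =ᶠ[nhds (extChartAt I x₀ y)] fun _ => e := by
  filter_upwards [eventually_symm_mem (I := I) hy] with z hz
  exact chartDeriv_constField hz.1 e

lemma localField_extend [IsManifold I 1 M] (x : M) (e : E) :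
    localField I x (FiberBundle.extend E (E := (TangentSpace I : M → Type _)) (x := x) e)
      =ᶠ[nhds (extChartAt I x x)] fun _ => e := by
  filter_upwards [eventually_symm_mem (I := I) (mem_chart_source H x)] with z hz
  exact (congrArg (chartDeriv I x _) (extend_eq_constField hz.1 _)).trans
    (chartDeriv_constField hz.1 e)

omit [I.Boundaryless] in
lemma contMDiffAt_constField [IsManifold I ∞ M] {x₀ y : M} (hy : y ∈ (chartAt H x₀).source)
    (e : E) : ContMDiffAt I I.tangent ∞ (fun x => (⟨x, constField I x₀ e x⟩ : TangentBundle I M))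
      y := by
  have h1 := (trivializationAt E (TangentSpace I : M → Type _) x₀).contMDiffAt_section_iff
    (n := ∞) (IB := I) (s := constField I x₀ e) (x₀ := y) hy
  refine h1.2 ((contMDiffAt_const (c := e)).congr_of_eventuallyEq ?_)
  filter_upwards [eventually_mem_source hy] with y' hy'
  have := chartDeriv_constField (I := I) hy' e
  rwa [chartDeriv, Trivialization.continuousLinearMapAt_apply,
    Trivialization.coe_linearMapAt_of_mem _ hy'] at this

/-- The bracket commutes with pullback along the inverse chart, and this pullback turns a vector
field into its component function. -/
lemma chartDeriv_mlieBracket [CompleteSpace E] [IsManifold I 2 M] {x₀ y : M}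
    (hy : y ∈ (chartAt H x₀).source) {V W : Π x : M, TangentSpace I x}
    (hV : MDifferentiableAt I I.tangent (fun x => (⟨x, V x⟩ : TangentBundle I M)) y)
    (hW : MDifferentiableAt I I.tangent (fun x => (⟨x, W x⟩ : TangentBundle I M)) y) :
    chartDeriv I x₀ y (VectorField.mlieBracket I V W y)
      = VectorField.lieBracket ℝ (localField I x₀ V) (localField I x₀ W) (extChartAt I x₀ y) := by
  have : IsManifold I (minSmoothness ℝ 2) M := by simpa using ‹IsManifold I 2 M›
  have hpull (U : Π x : M, TangentSpace I x) (z : E)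
      (hz : (extChartAt I x₀).symm z ∈ (chartAt H x₀).source ∧
        extChartAt I x₀ ((extChartAt I x₀).symm z) = z) :
      VectorField.mpullback 𝓘(ℝ, E) I (extChartAt I x₀).symm U z = localField I x₀ U z := by
    rw [VectorField.mpullback_apply, localField]
    generalize hx : (extChartAt I x₀).symm z = x at *
    obtain ⟨hz1, rfl⟩ := hz
    have h1 := TangentBundle.symmL_trivializationAt (I := I) hz1
    rw [I.range_eq_univ, mfderivWithin_univ] at h1
    -- The pullback applies the inverse of the differential of the inverse chart. That differential
    -- is `symmL`, with two-sided inverse `chartDeriv`.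
    have h2 : ((trivializationAt E (TangentSpace I : M → Type _) x₀).symmL ℝ x).inverse
        = chartDeriv I x₀ x := by
      refine ContinuousLinearMap.inverse_eq ?_ ?_
      · ext v
        exact constField_chartDeriv hz1 v
      · ext v
        exact chartDeriv_constField hz1 v
    rw [h1] at h2
    exact congrArg (fun L : TangentSpace I x →L[ℝ] E => L (U x)) h2
  have hev (U : Π x : M, TangentSpace I x) :
      VectorField.mpullback 𝓘(ℝ, E) I (extChartAt I x₀).symm U
        =ᶠ[nhds (extChartAt I x₀ y)] localField I x₀ U := by
    filter_upwards [eventually_symm_mem (I := I) hy] with z hz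
    exact hpull U z hz
  have h3 := VectorField.mpullback_mlieBracket (n := 2) (x₀ := extChartAt I x₀ y)
    (f := (extChartAt I x₀).symm) (V := V) (W := W) (I' := I) (I := 𝓘(ℝ, E))
    (by rwa [symm_extChartAt_apply hy]) (by rwa [symm_extChartAt_apply hy])
    (contMDiffAt_symm hy) (by simp)
  rw [(hev V).mlieBracket_vectorField_eq (hev W)] at h3
  have h4 (A B : Π z : E, TangentSpace 𝓘(ℝ, E) z) (z : E) :
      VectorField.mlieBracket 𝓘(ℝ, E) A B z = VectorField.lieBracket ℝ A B z := by
    rw [← VectorField.mlieBracketWithin_univ, VectorField.mlieBracketWithin_eq_lieBracketWithin]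
    exact congrFun VectorField.lieBracketWithin_univ z
  rw [← localField_apply hy, ← hpull _ _ (eventually_symm_mem (I := I) hy).self_of_nhds, h3]
  exact h4 _ _ _

end ChartCoordinates

/-! ### Christoffel symbols, curvature symmetries and lifts on a vector space. -/

section VectorSpace

variable {E : Type*} [NormedAddCommGroup E] [NormedSpace ℝ E]

/-- The Koszul expression `(a, b, c) ↦ (D_a G (b, c) + D_b G (a, c) - D_c G (a, b)) / 2` of a
field of bilinear forms on a vector space. -/
def koszulForm (G : E → E →L[ℝ] E →L[ℝ] ℝ) (z : E) : E →L[ℝ] E →L[ℝ] E →L[ℝ] ℝ :=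
  (1 / 2 : ℝ) • (fderiv ℝ G z + (fderiv ℝ G z).flip
    - ((ContinuousLinearMap.flipₗᵢ ℝ E E ℝ).toContinuousLinearEquiv :
        (E →L[ℝ] E →L[ℝ] ℝ) →L[ℝ] (E →L[ℝ] E →L[ℝ] ℝ)).comp (fderiv ℝ G z).flip)

lemma koszulForm_apply (G : E → E →L[ℝ] E →L[ℝ] ℝ) (z a b c : E) :
    koszulForm G z a b c
      = 1 / 2 * (fderiv ℝ G z a b c + fderiv ℝ G z b a c - fderiv ℝ G z c a b) := by
  simp [koszulForm]

/-- The Christoffel symbols `Γ (a, b)` of a field of nondegenerate bilinear forms. -/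
def christoffelSymbol (G : E → E →L[ℝ] E →L[ℝ] ℝ) (z : E) : E →L[ℝ] E →L[ℝ] E :=
  (ContinuousLinearMap.compL ℝ E (E →L[ℝ] ℝ) E (G z).inverse).comp (koszulForm G z)

lemma apply_christoffelSymbol {G : E → E →L[ℝ] E →L[ℝ] ℝ} {z : E} (hz : (G z).IsInvertible)
    (a b c : E) : G z (christoffelSymbol G z a b) c
      = 1 / 2 * (fderiv ℝ G z a b c + fderiv ℝ G z b a c - fderiv ℝ G z c a b) := by
  obtain ⟨e, he⟩ := hz
  have : G z ((G z).inverse (koszulForm G z a b)) = koszulForm G z a b := by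
    rw [← he, ContinuousLinearMap.inverse_equiv]
    exact e.apply_symm_apply _
  rw [← koszulForm_apply, ← this]
  rfl

/-- Definiteness gives injectivity, and `E` and its dual have the same finite dimension. -/
lemma isInvertible_of_pos [FiniteDimensional ℝ E] (B : E →L[ℝ] E →L[ℝ] ℝ)
    (hB : ∀ v, v ≠ 0 → 0 < B v v) : B.IsInvertible := by
  have hinj : Function.Injective (B : E →ₗ[ℝ] E →L[ℝ] ℝ) := by
    rw [injective_iff_map_eq_zero]
    intro v hv
    by_contra hne
    have h := hB v hne
    have h' : B v = 0 := hv
    simp [h'] at h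
  have hdim : Module.finrank ℝ E = Module.finrank ℝ (E →L[ℝ] ℝ) := by
    rw [← (LinearMap.toContinuousLinearMap (𝕜 := ℝ) (E := E) (F' := ℝ)).finrank_eq]
    exact Subspace.dual_finrank_eq.symm
  exact ⟨((B : E →ₗ[ℝ] E →L[ℝ] ℝ).linearEquivOfInjective hinj hdim).toContinuousLinearEquiv,
    by ext; rfl⟩

lemma contDiffAt_christoffelSymbol [CompleteSpace E] {G : E → E →L[ℝ] E →L[ℝ] ℝ} {z : E}
    (hG : ContDiffAt ℝ ∞ G z) (hz : (G z).IsInvertible) :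
    ContDiffAt ℝ ∞ (christoffelSymbol G) z := by
  have hD : ContDiffAt ℝ ∞ (fderiv ℝ G) z := hG.fderiv_right (by simp)
  have hflip : ContDiffAt ℝ ∞ (fun z => (fderiv ℝ G z).flip) z :=
    (ContinuousLinearMap.flipₗᵢ ℝ E E (E →L[ℝ] ℝ)).contDiff.contDiffAt.comp z hD
  have hk : ContDiffAt ℝ ∞ (koszulForm G) z :=
    ((hD.add hflip).sub (contDiffAt_const.clm_comp hflip)).const_smul (1 / 2 : ℝ)
  obtain ⟨e, he⟩ := hz
  have hinv : ContDiffAt ℝ ∞ (fun z => (G z).inverse) z := by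
    have h := contDiffAt_map_inverse (n := ∞) (𝕜 := ℝ) e
    rw [he] at h
    exact h.comp z hG
  exact ((ContinuousLinearMap.compL ℝ E (E →L[ℝ] ℝ) E).contDiff.contDiffAt.comp z hinv).clm_comp hk

lemma christoffelSymbol_symm {G : E → E →L[ℝ] E →L[ℝ] ℝ} {z : E} (hz : (G z).IsInvertible)
    (hsymm : ∀ a b c, fderiv ℝ G z a b c = fderiv ℝ G z a c b) (a b : E) :
    christoffelSymbol G z a b = christoffelSymbol G z b a := by
  have hinj : Function.Injective (G z) := by
    obtain ⟨e, he⟩ := hz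
    rw [← he]
    exact e.injective
  apply hinj
  ext c
  rw [apply_christoffelSymbol hz, apply_christoffelSymbol hz, hsymm c a b]
  ring

/-- Metric compatibility in coordinates: in the sum of the two Koszul expressions all derivatives
cancel except the one along `a`. -/
lemma fderiv_eq_christoffelSymbol {G : E → E →L[ℝ] E →L[ℝ] ℝ} {z : E} (hz : (G z).IsInvertible)
    (hG : ∀ a b, G z a b = G z b a)
    (hsymm : ∀ a b c, fderiv ℝ G z a b c = fderiv ℝ G z a c b) (a b c : E) :
    fderiv ℝ G z a b c
      = G z (christoffelSymbol G z a b) c + G z b (christoffelSymbol G z a c) := by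
  rw [hG b, apply_christoffelSymbol hz, apply_christoffelSymbol hz, hsymm c a b, hsymm b a c,
    hsymm a c b]
  ring

lemma fderiv_symm_of_eventually {G : E → E →L[ℝ] E →L[ℝ] ℝ} {z : E} (hd : DifferentiableAt ℝ G z)
    (hG : ∀ᶠ y in nhds z, ∀ a b, G y a b = G y b a) (a b c : E) :
    fderiv ℝ G z a b c = fderiv ℝ G z a c b := by
  have h1 (b c : E) : HasFDerivAt (fun y => G y b c)
      ((ContinuousLinearMap.apply ℝ ℝ c).comp
        ((ContinuousLinearMap.apply ℝ (E →L[ℝ] ℝ) b).comp (fderiv ℝ G z))) z :=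
    ((ContinuousLinearMap.apply ℝ ℝ c).hasFDerivAt).comp z
      (((ContinuousLinearMap.apply ℝ (E →L[ℝ] ℝ) b).hasFDerivAt).comp z hd.hasFDerivAt)
  have h2 : (fun y => G y b c) =ᶠ[nhds z] fun y => G y c b := hG.mono fun y hy => hy b c
  have h3 := (h1 b c).unique ((h1 c b).congr_of_eventuallyEq h2)
  exact congrArg (fun l => l a) h3

/-- The curvature `R (a, b) c` of the connection with Christoffel symbols `Γ`. -/
def localCurvature (Γ : E → E →L[ℝ] E →L[ℝ] E) (z a b c : E) : E :=
  fderiv ℝ Γ z a b c - fderiv ℝ Γ z b a c + Γ z a (Γ z b c) - Γ z b (Γ z a c)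

lemma localCurvature_skew (Γ : E → E →L[ℝ] E →L[ℝ] E) (z a b c : E) :
    localCurvature Γ z a b c = -localCurvature Γ z b a c := by
  simp only [localCurvature]
  abel

/-- First Bianchi identity. Symmetry of `Γ` near `z` passes to its derivative, after which the
cyclic sum cancels in pairs. -/
lemma localCurvature_bianchi {Γ : E → E →L[ℝ] E →L[ℝ] E} {z : E} (hd : DifferentiableAt ℝ Γ z)
    (hΓ : ∀ᶠ y in nhds z, ∀ a b, Γ y a b = Γ y b a) (a b c : E) :
    localCurvature Γ z a b c + localCurvature Γ z b c a + localCurvature Γ z c a b = 0 := by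
  have h1 (b c : E) : HasFDerivAt (fun y => Γ y b c)
      ((ContinuousLinearMap.apply ℝ E c).comp
        ((ContinuousLinearMap.apply ℝ (E →L[ℝ] E) b).comp (fderiv ℝ Γ z))) z :=
    ((ContinuousLinearMap.apply ℝ E c).hasFDerivAt).comp z
      (((ContinuousLinearMap.apply ℝ (E →L[ℝ] E) b).hasFDerivAt).comp z hd.hasFDerivAt)
  have h2 (a b c : E) : fderiv ℝ Γ z a b c = fderiv ℝ Γ z a c b := by
    have h2 : (fun y => Γ y b c) =ᶠ[nhds z] fun y => Γ y c b := hΓ.mono fun y hy => hy b c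
    exact congrArg (fun l => l a) ((h1 b c).unique ((h1 c b).congr_of_eventuallyEq h2))
  have h3 := hΓ.self_of_nhds
  simp only [localCurvature]
  rw [h2 a c b, h2 b a c, h2 c a b, h3 c a, h3 b a, h3 c b]
  abel

/-- Differentiating the compatibility of `Γ` with `G` once more and antisymmetrizing in `a`, `b`
removes the second derivative of `G` and leaves exactly the two curvature terms. -/
lemma localCurvature_metric_skew {G : E → E →L[ℝ] E →L[ℝ] ℝ} {Γ : E → E →L[ℝ] E →L[ℝ] E} {z : E}
    (hG : ContDiffAt ℝ 2 G z) (hd : DifferentiableAt ℝ Γ z)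
    (hΓ : ∀ᶠ y in nhds z, ∀ a b c, fderiv ℝ G y a b c = G y (Γ y a b) c + G y b (Γ y a c))
    (a b c d : E) :
    G z (localCurvature Γ z a b c) d + G z c (localCurvature Γ z a b d) = 0 := by
  have hGd : HasFDerivAt G (fderiv ℝ G z) z := (hG.differentiableAt two_ne_zero).hasFDerivAt
  have hDG : HasFDerivAt (fderiv ℝ G) (fderiv ℝ (fderiv ℝ G) z) z :=
    ((hG.fderiv_right (m := 1) (by norm_num)).differentiableAt one_ne_zero).hasFDerivAt
  have hsymm := second_derivative_symmetric_of_eventually (f := G) (f' := fderiv ℝ G)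
    ((hG.eventually (by simp)).mono fun y hy =>
      (hy.differentiableAt two_ne_zero).hasFDerivAt) hDG a b
  have hb (b e : E) : HasFDerivAt (fun y => Γ y b e)
      (((fderiv ℝ Γ z).flip b).flip e) z := by
    have h := (hd.hasFDerivAt.clm_apply (hasFDerivAt_const b z)).clm_apply (hasFDerivAt_const e z)
    refine h.congr_fderiv ?_
    ext
    simp
  have key (a b : E) : fderiv ℝ (fderiv ℝ G) z a b c d
      = fderiv ℝ G z a (Γ z b c) d + G z (fderiv ℝ Γ z a b c) d
        + fderiv ℝ G z a c (Γ z b d) + G z c (fderiv ℝ Γ z a b d) := by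
    have h1 := ((hDG.clm_apply (hasFDerivAt_const b z)).clm_apply
      (hasFDerivAt_const c z)).clm_apply (hasFDerivAt_const d z)
    have h2 := ((hGd.clm_apply (hb b c)).clm_apply (hasFDerivAt_const d z)).add
      ((hGd.clm_apply (hasFDerivAt_const c z)).clm_apply (hb b d))
    have h3 := h1.unique (h2.congr_of_eventuallyEq (hΓ.mono fun y hy => hy b c d))
    have h4 := congrArg (fun l => l a) h3
    simp at h4
    linarith
  have h1 := key a b
  have h2 := key b a
  -- The remaining first derivatives of `G` become the quadratic terms in `Γ`.
  rw [hΓ.self_of_nhds, hΓ.self_of_nhds] at h1 h2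
  rw [hsymm] at h1
  simp only [localCurvature, map_add, map_sub, add_apply, sub_apply]
  linarith

/-- Purely algebraic: skew symmetry in each pair together with the Bianchi identity implies pair
symmetry. -/
lemma localCurvature_pair_symm {G : E → E →L[ℝ] E →L[ℝ] ℝ} {Γ : E → E →L[ℝ] E →L[ℝ] E} {z : E}
    (hG : ContDiffAt ℝ 2 G z) (hd : DifferentiableAt ℝ Γ z)
    (hs : ∀ a b, G z a b = G z b a)
    (hΓs : ∀ᶠ y in nhds z, ∀ a b, Γ y a b = Γ y b a)
    (hΓ : ∀ᶠ y in nhds z, ∀ a b c, fderiv ℝ G y a b c = G y (Γ y a b) c + G y b (Γ y a c))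
    (a b c d : E) :
    G z (localCurvature Γ z a b c) d = G z (localCurvature Γ z c d a) b := by
  have sk (a b c d : E) : G z (localCurvature Γ z a b c) d
      = -G z (localCurvature Γ z b a c) d := by
    rw [localCurvature_skew]
    simp
  have sk' (a b c d : E) : G z (localCurvature Γ z a b c) d
      = -G z (localCurvature Γ z a b d) c := by
    have := localCurvature_metric_skew hG hd hΓ a b c d
    rw [hs c] at this
    linarith
  have bi (a b c d : E) : G z (localCurvature Γ z a b c) d + G z (localCurvature Γ z b c a) d
      + G z (localCurvature Γ z c a b) d = 0 := by
    have h := congrArg (fun v => G z v d) (localCurvature_bianchi hd hΓs a b c)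
    simpa using h
  -- The Bianchi identity for the four cyclic shifts of `(a, b, c, d)`. The instances of skew
  -- symmetry below match up their terms, and the claim is a linear combination.
  have b1 := bi a b c d
  have b2 := bi b c d a
  have b3 := bi c d a b
  have b4 := bi d a b c
  have e1 := sk' b c a d
  have e2 := sk' c d b a
  have e3 := sk' d a c b
  have e4 := sk' a b d c
  have e5 := sk c a b d
  have e6 := sk' a c b d
  have e7 := sk d b c a
  have e8 := sk' b d c a
  have e9 := sk' a c d b
  have e10 := sk' b d a c
  linarith

/-- The horizontal lift of a vector field on `E`, as a vector field on `E × E`. -/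
def localHorizontal (Γ : E → E →L[ℝ] E →L[ℝ] E) (X : E → E) (q : E × E) : E × E :=
  (X q.1, -Γ q.1 (X q.1) q.2)

/-- The vertical lift of a vector field on `E`, as a vector field on `E × E`. -/
def localVertical (X : E → E) (q : E × E) : E × E := (0, X q.1)

lemma hasFDerivAt_comp_fst {F : Type*} [NormedAddCommGroup F] [NormedSpace ℝ F] {X : E → F}
    {q : E × E} (hX : DifferentiableAt ℝ X q.1) :
    HasFDerivAt (fun q : E × E => X q.1)
      ((fderiv ℝ X q.1).comp (ContinuousLinearMap.fst ℝ E E)) q :=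
  HasFDerivAt.comp (f := Prod.fst) q hX.hasFDerivAt hasFDerivAt_fst

lemma differentiableAt_localVertical {X : E → E} {q : E × E} (hX : DifferentiableAt ℝ X q.1) :
    DifferentiableAt ℝ (localVertical X) q :=
  (differentiableAt_const _).prodMk (hasFDerivAt_comp_fst hX).differentiableAt

lemma fderiv_localVertical {X : E → E} {q : E × E} (hX : DifferentiableAt ℝ X q.1) (r : E × E) :
    fderiv ℝ (localVertical X) q r = (0, fderiv ℝ X q.1 r.1) := by
  have h := (hasFDerivAt_const (0 : E) q).prodMk (hasFDerivAt_comp_fst hX)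
  have h' : HasFDerivAt (localVertical X) _ q := h
  rw [h'.fderiv]
  simp

lemma hasFDerivAt_localHorizontal {Γ : E → E →L[ℝ] E →L[ℝ] E} {X : E → E} {q : E × E}
    (hΓ : DifferentiableAt ℝ Γ q.1) (hX : DifferentiableAt ℝ X q.1) :
    ∃ L : E × E →L[ℝ] E × E, HasFDerivAt (localHorizontal Γ X) L q ∧ ∀ r, L r
      = (fderiv ℝ X q.1 r.1, -(fderiv ℝ Γ q.1 r.1 (X q.1) q.2
          + Γ q.1 (fderiv ℝ X q.1 r.1) q.2 + Γ q.1 (X q.1) r.2)) := by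
  have h := (hasFDerivAt_comp_fst hX).prodMk
    (((hasFDerivAt_comp_fst hΓ).clm_apply (hasFDerivAt_comp_fst hX)).clm_apply
      (hasFDerivAt_snd (𝕜 := ℝ) (p := q))).neg
  refine ⟨_, h, fun r => ?_⟩
  simp
  abel

lemma differentiableAt_localHorizontal {Γ : E → E →L[ℝ] E →L[ℝ] E} {X : E → E} {q : E × E}
    (hΓ : DifferentiableAt ℝ Γ q.1) (hX : DifferentiableAt ℝ X q.1) :
    DifferentiableAt ℝ (localHorizontal Γ X) q := by
  obtain ⟨L, hL, -⟩ := hasFDerivAt_localHorizontal hΓ hX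
  exact hL.differentiableAt

lemma fderiv_localHorizontal {Γ : E → E →L[ℝ] E →L[ℝ] E} {X : E → E} {q : E × E}
    (hΓ : DifferentiableAt ℝ Γ q.1) (hX : DifferentiableAt ℝ X q.1) (r : E × E) :
    fderiv ℝ (localHorizontal Γ X) q r
      = (fderiv ℝ X q.1 r.1, -(fderiv ℝ Γ q.1 r.1 (X q.1) q.2
          + Γ q.1 (fderiv ℝ X q.1 r.1) q.2 + Γ q.1 (X q.1) r.2)) := by
  obtain ⟨L, hL, hr⟩ := hasFDerivAt_localHorizontal hΓ hX
  rw [hL.fderiv, hr]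

/-- The fibre component `-Γ(X, u)` depends on the base point and linearly on `u`. Differentiating
the former gives the `∂Γ` terms of the curvature, differentiating the latter along the other lift
gives the `ΓΓ` terms. -/
lemma lieBracket_localHorizontal {Γ : E → E →L[ℝ] E →L[ℝ] E} {X Y : E → E} {q : E × E}
    (hΓ : DifferentiableAt ℝ Γ q.1) (hX : DifferentiableAt ℝ X q.1)
    (hY : DifferentiableAt ℝ Y q.1) :
    VectorField.lieBracket ℝ (localHorizontal Γ X) (localHorizontal Γ Y) q
      = (VectorField.lieBracket ℝ X Y q.1,
          -Γ q.1 (VectorField.lieBracket ℝ X Y q.1) q.2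
            - localCurvature Γ q.1 (X q.1) (Y q.1) q.2) := by
  simp only [VectorField.lieBracket, fderiv_localHorizontal hΓ hX, fderiv_localHorizontal hΓ hY,
    localHorizontal, localCurvature]
  ext
  · simp
  · simp
    abel

/-- The second component is the coordinate form of `∇_X Y`; its `Γ` term is the derivative of `-Γ(X,
u)` in the fibre direction `Y`. -/
lemma lieBracket_localHorizontal_localVertical {Γ : E → E →L[ℝ] E →L[ℝ] E} {X Y : E → E}
    {q : E × E} (hΓ : DifferentiableAt ℝ Γ q.1) (hX : DifferentiableAt ℝ X q.1)
    (hY : DifferentiableAt ℝ Y q.1) :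
    VectorField.lieBracket ℝ (localHorizontal Γ X) (localVertical Y) q
      = (0, fderiv ℝ Y q.1 (X q.1) + Γ q.1 (X q.1) (Y q.1)) := by
  simp only [VectorField.lieBracket, fderiv_localHorizontal hΓ hX, fderiv_localVertical hY,
    localHorizontal, localVertical]
  ext <;> simp

lemma lieBracket_localVertical {X Y : E → E} {q : E × E} (hX : DifferentiableAt ℝ X q.1)
    (hY : DifferentiableAt ℝ Y q.1) :
    VectorField.lieBracket ℝ (localVertical X) (localVertical Y) q = 0 := by
  simp only [VectorField.lieBracket, fderiv_localVertical hX, fderiv_localVertical hY,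
    localVertical]
  simp

end VectorSpace

/-! ### The Koszul formula for an arbitrary Levi-Civita connection. -/

section Koszul

variable {E : Type*} [NormedAddCommGroup E] [NormedSpace ℝ E]
  {H : Type*} [TopologicalSpace H] {I : ModelWithCorners ℝ E H}
  {M : Type*} [TopologicalSpace M] [ChartedSpace H M] [IsManifold I 1 M]

/-- The Koszul formula. -/
lemma IsLeviCivita.koszul {G : RiemannianMetric (fun x : M => TangentSpace I x)}
    {cov : CovariantDerivative I E (fun x : M => TangentSpace I x)} (h : IsLeviCivita G cov)
    {A B C : Π x : M, TangentSpace I x} {x : M}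
    (hA : MDifferentiableAt I I.tangent (fun y => (⟨y, A y⟩ : TangentBundle I M)) x)
    (hB : MDifferentiableAt I I.tangent (fun y => (⟨y, B y⟩ : TangentBundle I M)) x)
    (hC : MDifferentiableAt I I.tangent (fun y => (⟨y, C y⟩ : TangentBundle I M)) x) :
    2 * G.inner x (cov B x (A x)) (C x)
      = mvfderiv I (fun y => G.inner y (B y) (C y)) x (A x)
        + mvfderiv I (fun y => G.inner y (A y) (C y)) x (B x)
        - mvfderiv I (fun y => G.inner y (A y) (B y)) x (C x)
        + G.inner x (VectorField.mlieBracket I A B x) (C x)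
        - G.inner x (VectorField.mlieBracket I A C x) (B x)
        - G.inner x (VectorField.mlieBracket I B C x) (A x) := by
  rw [h.metric B C x (A x) hB hC, h.metric A C x (B x) hA hC, h.metric A B x (C x) hA hB,
    ← h.torsion_free A B x hA hB, ← h.torsion_free A C x hA hC, ← h.torsion_free B C x hB hC]
  have e1 := G.symm x (A x) (cov C x (B x))
  have e2 := G.symm x (A x) (cov B x (C x))
  have e3 := G.symm x (B x) (cov C x (A x))
  simp only [map_sub, sub_apply]
  linarith

end Koszul

/-! ### Metric, Levi-Civita connection and curvature of the base in a chart. -/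

section Base

variable {E : Type*} [NormedAddCommGroup E] [NormedSpace ℝ E]
  {M : Type*} [TopologicalSpace M] [ChartedSpace E M] [IsManifold 𝓘(ℝ, E) ∞ M]

/-- The components of the metric in the preferred chart at `x₀`. -/
def localMetric (g : SmoothMetric E M) (x₀ : M) (z : E) : E →L[ℝ] E →L[ℝ] ℝ :=
  let y : M := (extChartAt 𝓘(ℝ, E) x₀).symm z
  let B : E →L[ℝ] E →L[ℝ] ℝ := g.inner y
  let D : E →L[ℝ] E :=
    (trivializationAt E (TangentSpace 𝓘(ℝ, E) : M → Type _) x₀).symmL ℝ y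
  B.bilinearComp D D

lemma localMetric_apply (g : SmoothMetric E M) (x₀ : M) (z a b : E) :
    localMetric g x₀ z a b = g.inner ((extChartAt 𝓘(ℝ, E) x₀).symm z)
      (constField 𝓘(ℝ, E) x₀ a _) (constField 𝓘(ℝ, E) x₀ b _) := rfl

lemma localMetric_symm (g : SmoothMetric E M) (x₀ : M) (z a b : E) :
    localMetric g x₀ z a b = localMetric g x₀ z b a := by
  rw [localMetric_apply, g.symm, localMetric_apply]

lemma localMetric_chartDeriv (g : SmoothMetric E M) {x₀ y : M} (hy : y ∈ (chartAt E x₀).source)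
    (v w : TangentSpace 𝓘(ℝ, E) y) :
    localMetric g x₀ (extChartAt 𝓘(ℝ, E) x₀ y) (chartDeriv 𝓘(ℝ, E) x₀ y v)
      (chartDeriv 𝓘(ℝ, E) x₀ y w) = g.inner y v w := by
  rw [localMetric_apply, symm_extChartAt_apply hy, constField_chartDeriv hy,
    constField_chartDeriv hy]

lemma isInvertible_localMetric [FiniteDimensional ℝ E] (g : SmoothMetric E M) {x₀ : M} {z : E}
    (hz : (extChartAt 𝓘(ℝ, E) x₀).symm z ∈ (chartAt E x₀).source) :
    (localMetric g x₀ z).IsInvertible := by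
  refine isInvertible_of_pos _ fun v hv => ?_
  rw [localMetric_apply]
  refine g.pos _ _ fun h0 => hv ?_
  have := chartDeriv_constField (I := 𝓘(ℝ, E)) hz v
  rw [h0, map_zero] at this
  exact this.symm

lemma contMDiffAt_inner (g : SmoothMetric E M) {y : M}
    {V W : Π x : M, TangentSpace 𝓘(ℝ, E) x}
    (hV : ContMDiffAt 𝓘(ℝ, E) 𝓘(ℝ, E).tangent ∞
      (fun x => (⟨x, V x⟩ : TangentBundle 𝓘(ℝ, E) M)) y)
    (hW : ContMDiffAt 𝓘(ℝ, E) 𝓘(ℝ, E).tangent ∞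
      (fun x => (⟨x, W x⟩ : TangentBundle 𝓘(ℝ, E) M)) y) :
    ContMDiffAt 𝓘(ℝ, E) 𝓘(ℝ, ℝ) ∞ (fun x => g.inner x (V x) (W x)) y := by
  have h := ContMDiffAt.clm_bundle_apply₂ (F₁ := E) (F₂ := E) (F₃ := ℝ) (E₃ := fun _ : M => ℝ)
    (b := fun x => x) (ψ := g.inner) (v := V) (w := W) (g.contMDiff y) hV hW
  exact (contMDiffAt_section y).1 h

lemma contDiffAt_localMetric [FiniteDimensional ℝ E] (g : SmoothMetric E M) {x₀ y : M}
    (hy : y ∈ (chartAt E x₀).source) :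
    ContDiffAt ℝ ∞ (localMetric g x₀) (extChartAt 𝓘(ℝ, E) x₀ y) := by
  have h : ContDiffOn ℝ ∞ (localMetric g x₀) (extChartAt 𝓘(ℝ, E) x₀).target := by
    -- In finite dimension, smoothness of a family of bilinear forms can be tested on fixed pairs of
    -- vectors.
    refine contDiffOn_clm_apply.2 fun a => contDiffOn_clm_apply.2 fun b => fun z hz => ?_
    have hy' := symm_mem_chart_source (I := 𝓘(ℝ, E)) hz
    have h1 := contDiffAt_comp_symm hy' (contMDiffAt_inner g
      (contMDiffAt_constField (I := 𝓘(ℝ, E)) hy' a) (contMDiffAt_constField hy' b))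
    rw [(extChartAt 𝓘(ℝ, E) x₀).right_inv hz] at h1
    exact h1.contDiffWithinAt
  exact h.contDiffAt (extChartAt_target_mem_nhds_apply hy)

/-- The Christoffel symbols of the metric in the preferred chart at `x₀`. -/
abbrev localChristoffel (g : SmoothMetric E M) (x₀ : M) : E → E →L[ℝ] E →L[ℝ] E :=
  christoffelSymbol (localMetric g x₀)

lemma contDiffAt_localChristoffel [FiniteDimensional ℝ E] (g : SmoothMetric E M) {x₀ y : M}
    (hy : y ∈ (chartAt E x₀).source) :
    ContDiffAt ℝ ∞ (localChristoffel g x₀) (extChartAt 𝓘(ℝ, E) x₀ y) := by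
  have : CompleteSpace E := FiniteDimensional.complete ℝ E
  exact contDiffAt_christoffelSymbol (contDiffAt_localMetric g hy)
    (isInvertible_localMetric g (by rwa [symm_extChartAt_apply hy]))

lemma fderiv_localMetric_symm [FiniteDimensional ℝ E] (g : SmoothMetric E M) {x₀ y : M}
    (hy : y ∈ (chartAt E x₀).source) (a b c : E) :
    fderiv ℝ (localMetric g x₀) (extChartAt 𝓘(ℝ, E) x₀ y) a b c
      = fderiv ℝ (localMetric g x₀) (extChartAt 𝓘(ℝ, E) x₀ y) a c b :=
  fderiv_symm_of_eventually ((contDiffAt_localMetric g hy).differentiableAt (by simp))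
    (Filter.Eventually.of_forall fun _ => localMetric_symm g x₀ _) a b c

lemma localChristoffel_symm [FiniteDimensional ℝ E] (g : SmoothMetric E M) {x₀ y : M}
    (hy : y ∈ (chartAt E x₀).source) (a b : E) :
    localChristoffel g x₀ (extChartAt 𝓘(ℝ, E) x₀ y) a b
      = localChristoffel g x₀ (extChartAt 𝓘(ℝ, E) x₀ y) b a :=
  christoffelSymbol_symm (isInvertible_localMetric g (by rwa [symm_extChartAt_apply hy]))
    (fderiv_localMetric_symm g hy) a b

lemma fderiv_localMetric [FiniteDimensional ℝ E] (g : SmoothMetric E M) {x₀ y : M}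
    (hy : y ∈ (chartAt E x₀).source) (a b c : E) :
    fderiv ℝ (localMetric g x₀) (extChartAt 𝓘(ℝ, E) x₀ y) a b c
      = localMetric g x₀ (extChartAt 𝓘(ℝ, E) x₀ y)
          (localChristoffel g x₀ (extChartAt 𝓘(ℝ, E) x₀ y) a b) c
        + localMetric g x₀ (extChartAt 𝓘(ℝ, E) x₀ y) b
          (localChristoffel g x₀ (extChartAt 𝓘(ℝ, E) x₀ y) a c) :=
  fderiv_eq_christoffelSymbol (isInvertible_localMetric g (by rwa [symm_extChartAt_apply hy]))
    (localMetric_symm g x₀ _) (fderiv_localMetric_symm g hy) a b c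

lemma mvfderiv_inner [FiniteDimensional ℝ E] (g : SmoothMetric E M) {x₀ y : M}
    (hy : y ∈ (chartAt E x₀).source) {V W : Π x : M, TangentSpace 𝓘(ℝ, E) x}
    (hV : DifferentiableAt ℝ (localField 𝓘(ℝ, E) x₀ V) (extChartAt 𝓘(ℝ, E) x₀ y))
    (hW : DifferentiableAt ℝ (localField 𝓘(ℝ, E) x₀ W) (extChartAt 𝓘(ℝ, E) x₀ y))
    (v : TangentSpace 𝓘(ℝ, E) y) :
    mvfderiv 𝓘(ℝ, E) (fun x => g.inner x (V x) (W x)) y v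
      = fderiv ℝ (localMetric g x₀) (extChartAt 𝓘(ℝ, E) x₀ y) (chartDeriv 𝓘(ℝ, E) x₀ y v)
          (localField 𝓘(ℝ, E) x₀ V (extChartAt 𝓘(ℝ, E) x₀ y))
          (localField 𝓘(ℝ, E) x₀ W (extChartAt 𝓘(ℝ, E) x₀ y))
        + localMetric g x₀ (extChartAt 𝓘(ℝ, E) x₀ y)
          (fderiv ℝ (localField 𝓘(ℝ, E) x₀ V) (extChartAt 𝓘(ℝ, E) x₀ y)
            (chartDeriv 𝓘(ℝ, E) x₀ y v))
          (localField 𝓘(ℝ, E) x₀ W (extChartAt 𝓘(ℝ, E) x₀ y))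
        + localMetric g x₀ (extChartAt 𝓘(ℝ, E) x₀ y)
          (localField 𝓘(ℝ, E) x₀ V (extChartAt 𝓘(ℝ, E) x₀ y))
          (fderiv ℝ (localField 𝓘(ℝ, E) x₀ W) (extChartAt 𝓘(ℝ, E) x₀ y)
            (chartDeriv 𝓘(ℝ, E) x₀ y v)) := by
  have hG := ((contDiffAt_localMetric g hy).differentiableAt (by simp)).hasFDerivAt
  have h1 := (hG.clm_apply hV.hasFDerivAt).clm_apply hW.hasFDerivAt
  have hev : (fun x => g.inner x (V x) (W x)) ∘ (extChartAt 𝓘(ℝ, E) x₀).symm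
      =ᶠ[nhds (extChartAt 𝓘(ℝ, E) x₀ y)] fun z =>
        localMetric g x₀ z (localField 𝓘(ℝ, E) x₀ V z) (localField 𝓘(ℝ, E) x₀ W z) := by
    filter_upwards [eventually_symm_mem (I := 𝓘(ℝ, E)) hy] with z hz
    have := localMetric_chartDeriv g hz.1 (V ((extChartAt 𝓘(ℝ, E) x₀).symm z))
      (W ((extChartAt 𝓘(ℝ, E) x₀).symm z))
    rw [hz.2] at this
    exact this.symm
  have h2 := h1.congr_of_eventuallyEq hev
  rw [mvfderiv_eq_fderiv hy ((mdifferentiableAt_iff_comp_symm hy).2 h2.differentiableAt),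
    h2.fderiv]
  simp
  ring

/-- The Levi-Civita connection in the preferred chart at `x₀`. -/
lemma chartDeriv_cov [FiniteDimensional ℝ E] {g : SmoothMetric E M} {cov : Connection E M}
    (hcov : IsLeviCivita g.toRiemannianMetric cov) {x₀ y : M}
    (hy : y ∈ (chartAt E x₀).source) {V : Π x : M, TangentSpace 𝓘(ℝ, E) x}
    (hV : DifferentiableAt ℝ (localField 𝓘(ℝ, E) x₀ V) (extChartAt 𝓘(ℝ, E) x₀ y))
    (v : TangentSpace 𝓘(ℝ, E) y) :
    chartDeriv 𝓘(ℝ, E) x₀ y (cov V y v)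
      = fderiv ℝ (localField 𝓘(ℝ, E) x₀ V) (extChartAt 𝓘(ℝ, E) x₀ y)
          (chartDeriv 𝓘(ℝ, E) x₀ y v)
        + localChristoffel g x₀ (extChartAt 𝓘(ℝ, E) x₀ y) (chartDeriv 𝓘(ℝ, E) x₀ y v)
          (localField 𝓘(ℝ, E) x₀ V (extChartAt 𝓘(ℝ, E) x₀ y)) := by
  have : CompleteSpace E := FiniteDimensional.complete ℝ E
  have hinv := isInvertible_localMetric g (x₀ := x₀) (z := extChartAt 𝓘(ℝ, E) x₀ y)
    (by rwa [symm_extChartAt_apply hy])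
  have hinj : Function.Injective (localMetric g x₀ (extChartAt 𝓘(ℝ, E) x₀ y)) := by
    obtain ⟨e, he⟩ := hinv
    rw [← he]
    exact e.injective
  apply hinj
  ext w
  set a := chartDeriv 𝓘(ℝ, E) x₀ y v with ha
  have hconst (e : E) := localField_constField (I := 𝓘(ℝ, E)) hy e
  have hdc (e : E) : DifferentiableAt ℝ (localField 𝓘(ℝ, E) x₀ (constField 𝓘(ℝ, E) x₀ e))
      (extChartAt 𝓘(ℝ, E) x₀ y) := (hconst e).differentiableAt_iff.2 (differentiableAt_const e)
  have hfc (e : E) : fderiv ℝ (localField 𝓘(ℝ, E) x₀ (constField 𝓘(ℝ, E) x₀ e))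
      (extChartAt 𝓘(ℝ, E) x₀ y) = 0 := by
    rw [(hconst e).fderiv_eq]
    simp
  have hvc (e : E) := (hconst e).self_of_nhds
  have hmd {U : Π x : M, TangentSpace 𝓘(ℝ, E) x}
      (hU : DifferentiableAt ℝ (localField 𝓘(ℝ, E) x₀ U) (extChartAt 𝓘(ℝ, E) x₀ y)) :=
    (mdifferentiableAt_iff_localField (I := 𝓘(ℝ, E)) hy).2 hU
  have hav : constField 𝓘(ℝ, E) x₀ a y = v := constField_chartDeriv hy v
  -- The direction `v` and the test vector are extended with constant components, so only the
  -- derivatives of `V` and of the metric survive.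
  have key := hcov.koszul (hmd (hdc a)) (hmd hV) (hmd (hdc w))
  rw [hav] at key
  have hk1 := mvfderiv_inner g hy hV (hdc w) v
  have hk2 := mvfderiv_inner g hy (hdc a) (hdc w) (V y)
  have hk3 := mvfderiv_inner g hy (hdc a) hV (constField 𝓘(ℝ, E) x₀ w y)
  have hb1 := chartDeriv_mlieBracket hy (hmd (hdc a)) (hmd hV)
  have hb2 := chartDeriv_mlieBracket hy (hmd (hdc a)) (hmd (hdc w))
  have hb3 := chartDeriv_mlieBracket hy (hmd hV) (hmd (hdc w))
  simp only [VectorField.lieBracket, hfc, hvc] at hb1 hb2 hb3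
  simp only [hfc, hvc, chartDeriv_constField hy] at hk1 hk2 hk3
  have htr (v w : TangentSpace 𝓘(ℝ, E) y) : g.toRiemannianMetric.inner y v w
      = localMetric g x₀ (extChartAt 𝓘(ℝ, E) x₀ y) (chartDeriv 𝓘(ℝ, E) x₀ y v)
        (chartDeriv 𝓘(ℝ, E) x₀ y w) := (localMetric_chartDeriv g hy v w).symm
  have hk1' : mvfderiv 𝓘(ℝ, E) (fun x => g.toRiemannianMetric.inner x (V x)
    (constField 𝓘(ℝ, E) x₀ w x)) y v = _ := hk1
  have hk2' : mvfderiv 𝓘(ℝ, E) (fun x => g.toRiemannianMetric.inner x (constField 𝓘(ℝ, E) x₀ a x)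
    (constField 𝓘(ℝ, E) x₀ w x)) y (V y) = _ := hk2
  have hk3' : mvfderiv 𝓘(ℝ, E) (fun x => g.toRiemannianMetric.inner x (constField 𝓘(ℝ, E) x₀ a x)
    (V x)) y (constField 𝓘(ℝ, E) x₀ w y) = _ := hk3
  rw [hk1', hk2', hk3', htr, htr, htr, htr, hb1, hb2, hb3, chartDeriv_constField hy,
    ← localField_apply hy] at key
  have e := localMetric_symm g x₀ (extChartAt 𝓘(ℝ, E) x₀ y)
  simp only [map_add, add_apply, apply_christoffelSymbol hinv]
  rw [← ha] at key
  generalize extChartAt 𝓘(ℝ, E) x₀ y = z at *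
  simp only [map_zero, zero_apply, zero_sub, sub_zero, map_neg, neg_apply, add_zero] at key
  have e1 := e a (fderiv ℝ (localField 𝓘(ℝ, E) x₀ V) z w)
  linarith

lemma differentiableAt_localChristoffel [FiniteDimensional ℝ E] (g : SmoothMetric E M) {x₀ y : M}
    (hy : y ∈ (chartAt E x₀).source) :
    DifferentiableAt ℝ (localChristoffel g x₀) (extChartAt 𝓘(ℝ, E) x₀ y) :=
  (contDiffAt_localChristoffel g hy).differentiableAt (by simp)

/-- The curvature tensor in the preferred chart at the point. -/
lemma curvature_eq_localCurvature [FiniteDimensional ℝ E] {g : SmoothMetric E M}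
    {cov : Connection E M} (hcov : IsLeviCivita g.toRiemannianMetric cov) (x : M) (a b c : E) :
    curvature cov x a b c
      = localCurvature (localChristoffel g x) (extChartAt 𝓘(ℝ, E) x x) a b c := by
  have : CompleteSpace E := FiniteDimensional.complete ℝ E
  have hx : x ∈ (chartAt E x).source := mem_chart_source E x
  have hΓ := (differentiableAt_localChristoffel g hx).hasFDerivAt
  let ext (e : E) (y : M) : TangentSpace 𝓘(ℝ, E) y :=
    FiberBundle.extend E (E := (TangentSpace 𝓘(ℝ, E) : M → Type _)) (x := x) e y
  have hext (e : E) : localField 𝓘(ℝ, E) x (ext e)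
      =ᶠ[nhds (extChartAt 𝓘(ℝ, E) x x)] fun _ => e := localField_extend x e
  have hself (e : E) : ext e x = e := FiberBundle.extend_apply_self E _
  -- The inner covariant derivative is to be differentiated again, so its components are needed on a
  -- neighbourhood and not only at `x`.
  have hnabla (b c : E) : localField 𝓘(ℝ, E) x (nabla cov (ext b) (ext c))
      =ᶠ[nhds (extChartAt 𝓘(ℝ, E) x x)] fun z => localChristoffel g x z b c := by
    filter_upwards [eventually_symm_mem (I := 𝓘(ℝ, E)) hx, (hext b).eventuallyEq_nhds,
      (hext c).eventuallyEq_nhds] with z hz hb hc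
    have h1 := chartDeriv_cov hcov hz.1 (V := ext c)
      (by rw [hz.2]; exact hc.differentiableAt_iff.2 (differentiableAt_const _)) (ext b _)
    rw [hz.2, hc.fderiv_eq, hc.self_of_nhds, fderiv_const_apply, zero_apply, zero_add] at h1
    refine h1.trans ?_
    have h2 := hb.self_of_nhds
    rw [localField] at h2
    rw [h2]
  have hd (b c : E) : HasFDerivAt (fun z => localChristoffel g x z b c)
      (((fderiv ℝ (localChristoffel g x) (extChartAt 𝓘(ℝ, E) x x)).flip b).flip c)
      (extChartAt 𝓘(ℝ, E) x x) := by
    generalize extChartAt 𝓘(ℝ, E) x x = z at *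
    have h := (hΓ.clm_apply (hasFDerivAt_const b z)).clm_apply (hasFDerivAt_const c z)
    refine h.congr_fderiv ?_
    ext
    simp
  have hsecond (a b c : E) : nabla cov (ext a) (nabla cov (ext b) (ext c)) x
      = fderiv ℝ (localChristoffel g x) (extChartAt 𝓘(ℝ, E) x x) a b c
        + localChristoffel g x (extChartAt 𝓘(ℝ, E) x x) a
          (localChristoffel g x (extChartAt 𝓘(ℝ, E) x x) b c) := by
    have h1 := chartDeriv_cov hcov hx
      ((hnabla b c).differentiableAt_iff.2 (hd b c).differentiableAt) (ext a x)
    rw [(hnabla b c).fderiv_eq, (hd b c).fderiv, (hnabla b c).self_of_nhds, chartDeriv_self,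
      chartDeriv_self, hself] at h1
    rw [nabla, hself]
    exact h1
  have hmd (e : E) := FiberBundle.mdifferentiableAt_extend
    (V := (TangentSpace 𝓘(ℝ, E) : M → Type _))
    𝓘(ℝ, E) E (x := x) e
  -- Fields with constant components commute, so the bracket term of the curvature drops out.
  have hbr : VectorField.mlieBracket 𝓘(ℝ, E) (ext a) (ext b) x = 0 := by
    have h1 := chartDeriv_mlieBracket (I := 𝓘(ℝ, E)) hx (V := ext a) (W := ext b) (hmd a) (hmd b)
    rw [VectorField.lieBracket, (hext a).fderiv_eq,
      (hext b).fderiv_eq, chartDeriv_self] at h1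
    rw [h1, fderiv_const_apply, fderiv_const_apply, zero_apply, zero_apply, sub_zero]
    rfl
  have h1 : nabla cov (VectorField.mlieBracket 𝓘(ℝ, E) (ext a) (ext b)) (ext c) x = 0 := by
    rw [nabla, hbr, map_zero]
  change nabla cov (ext a) (nabla cov (ext b) (ext c)) x
    - nabla cov (ext b) (nabla cov (ext a) (ext c)) x
    - nabla cov (VectorField.mlieBracket 𝓘(ℝ, E) (ext a) (ext b)) (ext c) x = _
  rw [hsecond, hsecond, h1, sub_zero]
  simp only [localCurvature]
  generalize extChartAt 𝓘(ℝ, E) x x = z at *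
  change (_ - _ : E) = _
  abel

/-- The Koszul formula on `TM` produces `g(R(X, Z)u, Y)` with the test field `Z` inside the
curvature; this symmetry moves `Z` out, giving `g(R(u, Y)X, Z)`. -/
lemma curvature_pair_symm [FiniteDimensional ℝ E] {g : SmoothMetric E M}
    {cov : Connection E M} (hcov : IsLeviCivita g.toRiemannianMetric cov) (x : M)
    (a b c d : TangentSpace 𝓘(ℝ, E) x) :
    g.inner x (curvature cov x a b c) d = g.inner x (curvature cov x c d a) b := by
  have hx : x ∈ (chartAt E x).source := mem_chart_source E x
  have hev {P : E → Prop} (h : ∀ y ∈ (chartAt E x).source, P (extChartAt 𝓘(ℝ, E) x y)) :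
      ∀ᶠ z in nhds (extChartAt 𝓘(ℝ, E) x x), P z := by
    filter_upwards [eventually_symm_mem (I := 𝓘(ℝ, E)) hx] with z hz
    have := h _ hz.1
    rwa [hz.2] at this
  have h := localCurvature_pair_symm (G := localMetric g x) (Γ := localChristoffel g x)
    ((contDiffAt_localMetric g hx).of_le (by norm_cast))
    (differentiableAt_localChristoffel g hx) (localMetric_symm g x _)
    (hev fun y hy => localChristoffel_symm g hy) (hev fun y hy => fderiv_localMetric g hy) a b c d
  have h1 := localMetric_chartDeriv g hx (curvature cov x a b c) d
  have h2 := localMetric_chartDeriv g hx (curvature cov x c d a) b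
  rw [chartDeriv_self, chartDeriv_self] at h1 h2
  rw [← h1, ← h2]
  exact (congrArg (fun w : E => localMetric g x _ w d)
    (curvature_eq_localCurvature hcov x a b c)).trans (h.trans
      (congrArg (fun w : E => localMetric g x _ w b)
        (curvature_eq_localCurvature hcov x c d a).symm))

end Base

/-- Tangent vectors at `y` are written in the chart at `y`, so `chartDeriv` at `y` is the derivative
of a transition map. On `TM` it can therefore be evaluated along conveniently chosen maps into a
chart. -/
lemma hasFDerivAt_chart_change {E : Type*} [NormedAddCommGroup E] [NormedSpace ℝ E]
    {H : Type*} [TopologicalSpace H] {I : ModelWithCorners ℝ E H} [I.Boundaryless]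
    {M : Type*} [TopologicalSpace M] [ChartedSpace H M] [IsManifold I 1 M] {x₀ y : M}
    (hy : y ∈ (chartAt H x₀).source) :
    HasFDerivAt (extChartAt I x₀ ∘ (extChartAt I y).symm) (chartDeriv I x₀ y : E →L[ℝ] E)
      (extChartAt I y y) := by
  have h := hasFDerivWithinAt_tangentCoordChange (I := I) (x := y) (y := x₀) (z := y)
    ⟨mem_extChartAt_source y, by rwa [extChartAt_source]⟩
  rw [I.range_eq_univ, hasFDerivWithinAt_univ] at h
  exact h.congr_fderiv (TangentBundle.continuousLinearMapAt_trivializationAt_eq_core hy).symm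

/-! ### Lifted tangent vectors in the charts of the tangent bundle. -/

section TangentBundle

variable {E : Type*} [NormedAddCommGroup E] [NormedSpace ℝ E]
  {M : Type*} [TopologicalSpace M] [ChartedSpace E M] [IsManifold 𝓘(ℝ, E) ∞ M]

lemma extChartAt_tangent_apply {p q : TangentBundle 𝓘(ℝ, E) M}
    (hq : q.1 ∈ (chartAt E p.1).source) :
    extChartAt 𝓘(ℝ, E).tangent p q
      = (extChartAt 𝓘(ℝ, E) p.1 q.1, chartDeriv 𝓘(ℝ, E) p.1 q.1 q.2) := by
  rw [chartDeriv, Trivialization.continuousLinearMapAt_apply,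
    Trivialization.coe_linearMapAt_of_mem _ hq]
  rfl

lemma extChartAt_tangent_self (p : TangentBundle 𝓘(ℝ, E) M) :
    extChartAt 𝓘(ℝ, E).tangent p p = (extChartAt 𝓘(ℝ, E) p.1 p.1, p.2) := by
  rw [extChartAt_tangent_apply (mem_chart_source E p.1), chartDeriv_self]
  rfl

lemma extChartAt_tangent_symm_mk {p : TangentBundle 𝓘(ℝ, E) M} {y : M}
    (hy : y ∈ (chartAt E p.1).source) (v : TangentSpace 𝓘(ℝ, E) y) :
    (extChartAt 𝓘(ℝ, E).tangent p).symm
      (extChartAt 𝓘(ℝ, E) p.1 y, chartDeriv 𝓘(ℝ, E) p.1 y v) = ⟨y, v⟩ := by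
  have h := symm_extChartAt_apply (I := 𝓘(ℝ, E).tangent) (x₀ := p)
    (y := (⟨y, v⟩ : TangentBundle 𝓘(ℝ, E) M)) ((TangentBundle.mem_chart_source_iff _ _).2 hy)
  rwa [extChartAt_tangent_apply hy] at h

/-- On a single fibre the transition map of `TM` is linear, hence equal to its own derivative in
fibre directions. -/
lemma chartDeriv_verticalLift {p q : TangentBundle 𝓘(ℝ, E) M}
    (hq : q.1 ∈ (chartAt E p.1).source) (w : TangentSpace 𝓘(ℝ, E) q.1) :
    chartDeriv 𝓘(ℝ, E).tangent p q (verticalLift q w) = (0, chartDeriv 𝓘(ℝ, E) p.1 q.1 w) := by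
  have h := hasFDerivAt_chart_change (I := 𝓘(ℝ, E).tangent) (x₀ := p) (y := q)
    ((TangentBundle.mem_chart_source_iff _ _).2 hq)
  rw [extChartAt_tangent_self] at h
  have hc : HasFDerivAt (fun t : E => (extChartAt 𝓘(ℝ, E) q.1 q.1, t))
      (ContinuousLinearMap.inr ℝ E E) q.2 :=
    hasFDerivAt_prodMk_right (E := E) (F := E) _ q.2
  have h1 := HasFDerivAt.comp (f := fun t : E => (extChartAt 𝓘(ℝ, E) q.1 q.1, t)) q.2 h hc
  have h2 : HasFDerivAt (fun t : E => (extChartAt 𝓘(ℝ, E) p.1 q.1,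
      (chartDeriv 𝓘(ℝ, E) p.1 q.1 : E →L[ℝ] E) t))
      ((0 : E →L[ℝ] E).prod (chartDeriv 𝓘(ℝ, E) p.1 q.1 : E →L[ℝ] E)) q.2 :=
    (hasFDerivAt_const _ _).prodMk (chartDeriv 𝓘(ℝ, E) p.1 q.1 : E →L[ℝ] E).hasFDerivAt
  have h3 : (extChartAt 𝓘(ℝ, E).tangent p ∘ (extChartAt 𝓘(ℝ, E).tangent q).symm) ∘
      (fun t : E => (extChartAt 𝓘(ℝ, E) q.1 q.1, t)) = fun t : E =>
        (extChartAt 𝓘(ℝ, E) p.1 q.1, (chartDeriv 𝓘(ℝ, E) p.1 q.1 : E →L[ℝ] E) t) := by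
    funext t
    have h4 := (congrArg (fun r : E => (extChartAt 𝓘(ℝ, E).tangent q).symm
      (extChartAt 𝓘(ℝ, E) q.1 q.1, r)) (chartDeriv_self q.1 t)).symm.trans
        (extChartAt_tangent_symm_mk (p := q) (mem_chart_source E q.1) (v := t))
    simp only [Function.comp_apply]
    exact (congrArg _ h4).trans (extChartAt_tangent_apply (q := ⟨q.1, t⟩) hq)
  rw [h3] at h1
  exact congrArg (fun L : E →L[ℝ] E × E => L w) (h1.unique h2)

/-- The horizontal lift subtracts the connection from the differential of a section. -/
lemma chartDeriv_mkTM_fderiv {p q : TangentBundle 𝓘(ℝ, E) M}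
    (hq : q.1 ∈ (chartAt E p.1).source) (v : TangentSpace 𝓘(ℝ, E) q.1) :
    chartDeriv 𝓘(ℝ, E).tangent p q (mkTM q v (fderiv ℝ (localField 𝓘(ℝ, E) q.1
      (constField 𝓘(ℝ, E) p.1 (chartDeriv 𝓘(ℝ, E) p.1 q.1 q.2))) (extChartAt 𝓘(ℝ, E) q.1 q.1) v))
      = (chartDeriv 𝓘(ℝ, E) p.1 q.1 v, 0) := by
  -- The section `s` passes through `q` and has constant components in the chart at `p.1`.
  -- Differentiating `s`, as a map into `TM`, in both charts relates `(v, ds(v))` to `(v, 0)`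
  -- without any second derivative of a transition map.
  set e := chartDeriv 𝓘(ℝ, E) p.1 q.1 q.2
  set s := constField 𝓘(ℝ, E) p.1 e
  have hs : s q.1 = q.2 := constField_chartDeriv hq _
  have hqq := mem_chart_source E q.1
  have hd : DifferentiableAt ℝ (localField 𝓘(ℝ, E) q.1 s) (extChartAt 𝓘(ℝ, E) q.1 q.1) :=
    (contDiffAt_localField hqq (contMDiffAt_constField hq e)).differentiableAt (by simp)
  have hc : HasFDerivAt (fun z => (z, localField 𝓘(ℝ, E) q.1 s z))
      ((ContinuousLinearMap.id ℝ E).prod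
        (fderiv ℝ (localField 𝓘(ℝ, E) q.1 s) (extChartAt 𝓘(ℝ, E) q.1 q.1)))
      (extChartAt 𝓘(ℝ, E) q.1 q.1) := (hasFDerivAt_id _).prodMk hd.hasFDerivAt
  have h := hasFDerivAt_chart_change (I := 𝓘(ℝ, E).tangent) (x₀ := p) (y := q)
    ((TangentBundle.mem_chart_source_iff _ _).2 hq)
  have h0 : extChartAt 𝓘(ℝ, E).tangent q q
      = (extChartAt 𝓘(ℝ, E) q.1 q.1,
          localField 𝓘(ℝ, E) q.1 s (extChartAt 𝓘(ℝ, E) q.1 q.1)) := by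
    rw [extChartAt_tangent_self, localField_apply hqq, hs, chartDeriv_self]
    rfl
  rw [h0] at h
  have h1 := HasFDerivAt.comp (f := fun z => (z, localField 𝓘(ℝ, E) q.1 s z))
    (extChartAt 𝓘(ℝ, E) q.1 q.1) h hc
  have h2 : HasFDerivAt (fun z : E => ((extChartAt 𝓘(ℝ, E) p.1 ∘ (extChartAt 𝓘(ℝ, E) q.1).symm) z,
      e)) ((chartDeriv 𝓘(ℝ, E) p.1 q.1 : E →L[ℝ] E).prod (0 : E →L[ℝ] E))
      (extChartAt 𝓘(ℝ, E) q.1 q.1) :=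
    (hasFDerivAt_chart_change hq).prodMk (hasFDerivAt_const _ _)
  have h3 : (extChartAt 𝓘(ℝ, E).tangent p ∘ (extChartAt 𝓘(ℝ, E).tangent q).symm) ∘
      (fun z => (z, localField 𝓘(ℝ, E) q.1 s z)) =ᶠ[nhds (extChartAt 𝓘(ℝ, E) q.1 q.1)]
      fun z : E => ((extChartAt 𝓘(ℝ, E) p.1 ∘ (extChartAt 𝓘(ℝ, E) q.1).symm) z, e) := by
    have hcont : ContinuousAt (extChartAt 𝓘(ℝ, E) q.1).symm (extChartAt 𝓘(ℝ, E) q.1 q.1) :=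
      continuousAt_extChartAt_symm q.1
    have hmem := hcont.eventually (by
      rw [symm_extChartAt_apply hqq]
      exact eventually_mem_source hq)
    filter_upwards [eventually_symm_mem (I := 𝓘(ℝ, E)) hqq, hmem] with z hz hz'
    have h4 := extChartAt_tangent_symm_mk (p := q) hz.1 (s _)
    rw [hz.2] at h4
    simp only [Function.comp_apply]
    refine (congrArg _ h4).trans ((extChartAt_tangent_apply
      (q := ⟨(extChartAt 𝓘(ℝ, E) q.1).symm z, s _⟩) hz').trans ?_)
    exact congrArg _ (chartDeriv_constField hz' e)
  have h4 := h2.congr_of_eventuallyEq h3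
  exact congrArg (fun L : E →L[ℝ] E × E => L v) (HasFDerivAt.unique (E := E) (F := E × E) h1 h4)

variable [FiniteDimensional ℝ E]

/-- The constant extension of `u` has zero coordinate derivative, so its covariant derivative is the
Christoffel term alone. -/
lemma christoffel_eq_localChristoffel {g : SmoothMetric E M} {cov : Connection E M}
    (hcov : IsLeviCivita g.toRiemannianMetric cov) (p : TangentBundle 𝓘(ℝ, E) M)
    (v : TangentSpace 𝓘(ℝ, E) p.1) :
    christoffel cov p v
      = localChristoffel g p.1 (extChartAt 𝓘(ℝ, E) p.1 p.1) v p.2 := by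
  have hx := mem_chart_source E p.1
  obtain ⟨u, hu⟩ : ∃ u : E, u = p.2 := ⟨_, rfl⟩
  have hext := localField_extend (I := 𝓘(ℝ, E)) p.1 u
  have h := chartDeriv_cov hcov hx (hext.differentiableAt_iff.2 (differentiableAt_const _)) v
  rw [hext.fderiv_eq, hext.self_of_nhds, fderiv_const_apply, zero_apply, zero_add, chartDeriv_self,
    chartDeriv_self, hu] at h
  exact h

/-- For a section `s` through `q`, the horizontal lift of `v` is `ds(v) - (∇_v s)^V`, which does not
depend on a chart. Taking `s` constant in the chart at `p.1` makes the first term trivial and the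
second one the Christoffel term. -/
lemma chartDeriv_horizontalLift {g : SmoothMetric E M} {cov : Connection E M}
    (hcov : IsLeviCivita g.toRiemannianMetric cov) {p q : TangentBundle 𝓘(ℝ, E) M}
    (hq : q.1 ∈ (chartAt E p.1).source) (v : TangentSpace 𝓘(ℝ, E) q.1) :
    chartDeriv 𝓘(ℝ, E).tangent p q (horizontalLift cov q v)
      = (chartDeriv 𝓘(ℝ, E) p.1 q.1 v, -localChristoffel g p.1 (extChartAt 𝓘(ℝ, E) p.1 q.1)
          (chartDeriv 𝓘(ℝ, E) p.1 q.1 v) (chartDeriv 𝓘(ℝ, E) p.1 q.1 q.2)) := by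
  have hqq := mem_chart_source E q.1
  have hm := chartDeriv_mkTM_fderiv hq v
  set e := chartDeriv 𝓘(ℝ, E) p.1 q.1 q.2
  set s := constField 𝓘(ℝ, E) p.1 e
  have hs : s q.1 = q.2 := constField_chartDeriv hq _
  have hd : DifferentiableAt ℝ (localField 𝓘(ℝ, E) q.1 s) (extChartAt 𝓘(ℝ, E) q.1 q.1) :=
    (contDiffAt_localField hqq (contMDiffAt_constField hq e)).differentiableAt (by simp)
  have h1 := chartDeriv_cov hcov hqq hd v
  rw [localField_apply hqq, hs, chartDeriv_self, chartDeriv_self, chartDeriv_self] at h1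
  have hconst := localField_constField (I := 𝓘(ℝ, E)) hq e
  have h2 := chartDeriv_cov hcov hq (hconst.differentiableAt_iff.2 (differentiableAt_const _)) v
  rw [hconst.fderiv_eq, hconst.self_of_nhds, fderiv_const_apply, zero_apply, zero_add] at h2
  -- In the chart at `q` this is `-Γ(v, u) = ds(v) - ∇_v s`.
  have h3 : horizontalLift cov q v = mkTM q v (fderiv ℝ (localField 𝓘(ℝ, E) q.1 s)
      (extChartAt 𝓘(ℝ, E) q.1 q.1) v) - verticalLift q (cov s q.1 v) := by
    have h4 := christoffel_eq_localChristoffel hcov q v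
    have h5 (c d k : E) (h : c = d + k) : -k = d - c := by
      rw [h]
      abel
    exact Prod.ext (sub_zero (v : E)).symm
      ((congrArg (fun w : E => -w) h4).trans (h5 _ _ _ h1))
  rw [h3, map_sub, hm, chartDeriv_verticalLift hq, h2]
  simp

end TangentBundle

/-! ### Lie brackets of lifted fields and derivatives of functions pulled back from the base. -/

section LiftedFields

variable {E : Type*} [NormedAddCommGroup E] [NormedSpace ℝ E]
  {M : Type*} [TopologicalSpace M] [ChartedSpace E M] [IsManifold 𝓘(ℝ, E) ∞ M]

lemma mem_chart_source_tangent_self (p : TangentBundle 𝓘(ℝ, E) M) :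
    p ∈ (chartAt (ModelProd E E) p).source := mem_chart_source _ p

/-- A property of points of `E × E` near the coordinates of `p` can be checked on the points of
`TM`. -/
lemma eventually_of_forall_tangent (p : TangentBundle 𝓘(ℝ, E) M) {P : E × E → Prop}
    (h : ∀ q : TangentBundle 𝓘(ℝ, E) M, q.1 ∈ (chartAt E p.1).source →
      (extChartAt 𝓘(ℝ, E).tangent p).symm (extChartAt 𝓘(ℝ, E).tangent p q) = q →
      P (extChartAt 𝓘(ℝ, E).tangent p q)) :
    ∀ᶠ r in nhds (extChartAt 𝓘(ℝ, E).tangent p p), P r := by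
  filter_upwards [eventually_symm_mem (I := 𝓘(ℝ, E).tangent) (mem_chart_source_tangent_self p)]
    with r hr
  have := h _ ((TangentBundle.mem_chart_source_iff _ _).1 hr.1) (by rw [hr.2])
  rwa [hr.2] at this

lemma localField_verticalField (p : TangentBundle 𝓘(ℝ, E) M)
    (Y : Π x : M, TangentSpace 𝓘(ℝ, E) x) :
    localField 𝓘(ℝ, E).tangent p (verticalField Y)
      =ᶠ[nhds (extChartAt 𝓘(ℝ, E).tangent p p)] localVertical (localField 𝓘(ℝ, E) p.1 Y) := by
  refine eventually_of_forall_tangent p fun q hq hqs => ?_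
  rw [localField, hqs, verticalField, chartDeriv_verticalLift hq, extChartAt_tangent_apply hq,
    localVertical, localField_apply hq]

variable [FiniteDimensional ℝ E]

/-- `horizontalField` uses a different chart at every point; differentiating it requires its
expression in one fixed chart around `p`. -/
lemma localField_horizontalField {g : SmoothMetric E M} {cov : Connection E M}
    (hcov : IsLeviCivita g.toRiemannianMetric cov) (p : TangentBundle 𝓘(ℝ, E) M)
    (X : Π x : M, TangentSpace 𝓘(ℝ, E) x) :
    localField 𝓘(ℝ, E).tangent p (horizontalField cov X)
      =ᶠ[nhds (extChartAt 𝓘(ℝ, E).tangent p p)]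
        localHorizontal (localChristoffel g p.1) (localField 𝓘(ℝ, E) p.1 X) := by
  refine eventually_of_forall_tangent p fun q hq hqs => ?_
  rw [localField, hqs, horizontalField, chartDeriv_horizontalLift hcov hq,
    extChartAt_tangent_apply hq, localHorizontal, localField_apply hq]

omit [FiniteDimensional ℝ E] in
lemma mdifferentiableAt_verticalField {p : TangentBundle 𝓘(ℝ, E) M}
    {Y : Π x : M, TangentSpace 𝓘(ℝ, E) x}
    (hY : MDifferentiableAt 𝓘(ℝ, E) 𝓘(ℝ, E).tangent
      (fun x => (⟨x, Y x⟩ : TangentBundle 𝓘(ℝ, E) M)) p.1) :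
    MDifferentiableAt 𝓘(ℝ, E).tangent 𝓘(ℝ, E).tangent.tangent
      (fun q => (⟨q, verticalField Y q⟩ :
        TangentBundle 𝓘(ℝ, E).tangent (TangentBundle 𝓘(ℝ, E) M))) p := by
  rw [mdifferentiableAt_iff_localField (mem_chart_source_tangent_self p),
    (localField_verticalField p Y).differentiableAt_iff,
    extChartAt_tangent_apply (mem_chart_source E p.1)]
  exact differentiableAt_localVertical
    ((mdifferentiableAt_iff_localField (mem_chart_source E p.1)).1 hY)

lemma mdifferentiableAt_horizontalField {g : SmoothMetric E M} {cov : Connection E M}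
    (hcov : IsLeviCivita g.toRiemannianMetric cov) {p : TangentBundle 𝓘(ℝ, E) M}
    {X : Π x : M, TangentSpace 𝓘(ℝ, E) x}
    (hX : MDifferentiableAt 𝓘(ℝ, E) 𝓘(ℝ, E).tangent
      (fun x => (⟨x, X x⟩ : TangentBundle 𝓘(ℝ, E) M)) p.1) :
    MDifferentiableAt 𝓘(ℝ, E).tangent 𝓘(ℝ, E).tangent.tangent
      (fun q => (⟨q, horizontalField cov X q⟩ :
        TangentBundle 𝓘(ℝ, E).tangent (TangentBundle 𝓘(ℝ, E) M))) p := by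
  rw [mdifferentiableAt_iff_localField (mem_chart_source_tangent_self p),
    (localField_horizontalField hcov p X).differentiableAt_iff,
    extChartAt_tangent_apply (mem_chart_source E p.1)]
  exact differentiableAt_localHorizontal
    (differentiableAt_localChristoffel g (mem_chart_source E p.1))
    ((mdifferentiableAt_iff_localField (mem_chart_source E p.1)).1 hX)

omit [FiniteDimensional ℝ E] in
lemma lieBracket_congr {V V' W W' : E × E → E × E} {r : E × E} (hV : V =ᶠ[nhds r] V')
    (hW : W =ᶠ[nhds r] W') :
    VectorField.lieBracket ℝ V W r = VectorField.lieBracket ℝ V' W' r := by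
  rw [VectorField.lieBracket, VectorField.lieBracket, hV.fderiv_eq, hW.fderiv_eq,
    hV.self_of_nhds, hW.self_of_nhds]

/-- `[X^H, Y^H] = [X, Y]^H - (R(X, Y)u)^V`. -/
lemma mlieBracket_horizontalField {g : SmoothMetric E M} {cov : Connection E M}
    (hcov : IsLeviCivita g.toRiemannianMetric cov) {p : TangentBundle 𝓘(ℝ, E) M}
    {X Y : Π x : M, TangentSpace 𝓘(ℝ, E) x}
    (hX : MDifferentiableAt 𝓘(ℝ, E) 𝓘(ℝ, E).tangent
      (fun x => (⟨x, X x⟩ : TangentBundle 𝓘(ℝ, E) M)) p.1)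
    (hY : MDifferentiableAt 𝓘(ℝ, E) 𝓘(ℝ, E).tangent
      (fun x => (⟨x, Y x⟩ : TangentBundle 𝓘(ℝ, E) M)) p.1) :
    VectorField.mlieBracket 𝓘(ℝ, E).tangent (horizontalField cov X) (horizontalField cov Y) p
      = horizontalLift cov p (VectorField.mlieBracket 𝓘(ℝ, E) X Y p.1)
        - verticalLift p (curvature cov p.1 (X p.1) (Y p.1) p.2) := by
  have : CompleteSpace E := FiniteDimensional.complete ℝ E
  have hx := mem_chart_source E p.1
  have hp := mem_chart_source_tangent_self p
  have hX' := (mdifferentiableAt_iff_localField hx).1 hX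
  have hY' := (mdifferentiableAt_iff_localField hx).1 hY
  apply chartDeriv_injective hp
  rw [chartDeriv_mlieBracket hp (mdifferentiableAt_horizontalField hcov hX)
    (mdifferentiableAt_horizontalField hcov hY),
    lieBracket_congr (localField_horizontalField hcov p X) (localField_horizontalField hcov p Y),
    map_sub, chartDeriv_horizontalLift hcov hx, chartDeriv_verticalLift hx,
    extChartAt_tangent_apply hx, lieBracket_localHorizontal
      (differentiableAt_localChristoffel g hx) hX' hY',
    chartDeriv_mlieBracket hx hX hY]
  have h1 := localField_apply hx X
  have h2 := localField_apply hx Y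
  rw [chartDeriv_self] at h1 h2
  have h3 : chartDeriv 𝓘(ℝ, E) p.1 p.1 (curvature cov p.1 (X p.1) (Y p.1) p.2)
      = localCurvature (localChristoffel g p.1) (extChartAt 𝓘(ℝ, E) p.1 p.1) (X p.1) (Y p.1) p.2 :=
    (chartDeriv_self _ _).trans (curvature_eq_localCurvature hcov p.1 _ _ _)
  have h4 : chartDeriv 𝓘(ℝ, E) p.1 p.1 p.2 = p.2 := chartDeriv_self _ _
  rw [h1, h2, h3]
  refine Prod.ext (sub_zero _).symm ?_
  exact congrArg (fun w : E => -localChristoffel g p.1 (extChartAt 𝓘(ℝ, E) p.1 p.1)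
    (VectorField.lieBracket ℝ (localField 𝓘(ℝ, E) p.1 X) (localField 𝓘(ℝ, E) p.1 Y)
      (extChartAt 𝓘(ℝ, E) p.1 p.1)) (chartDeriv 𝓘(ℝ, E) p.1 p.1 p.2)
    - localCurvature (localChristoffel g p.1) (extChartAt 𝓘(ℝ, E) p.1 p.1) (X p.1) (Y p.1) w) h4

/-- `[X^H, Y^V] = (∇_X Y)^V`. -/
lemma mlieBracket_horizontalField_verticalField {g : SmoothMetric E M} {cov : Connection E M}
    (hcov : IsLeviCivita g.toRiemannianMetric cov) {p : TangentBundle 𝓘(ℝ, E) M}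
    {X Y : Π x : M, TangentSpace 𝓘(ℝ, E) x}
    (hX : MDifferentiableAt 𝓘(ℝ, E) 𝓘(ℝ, E).tangent
      (fun x => (⟨x, X x⟩ : TangentBundle 𝓘(ℝ, E) M)) p.1)
    (hY : MDifferentiableAt 𝓘(ℝ, E) 𝓘(ℝ, E).tangent
      (fun x => (⟨x, Y x⟩ : TangentBundle 𝓘(ℝ, E) M)) p.1) :
    VectorField.mlieBracket 𝓘(ℝ, E).tangent (horizontalField cov X) (verticalField Y) p
      = verticalLift p (nabla cov X Y p.1) := by
  have : CompleteSpace E := FiniteDimensional.complete ℝ E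
  have hx := mem_chart_source E p.1
  have hp := mem_chart_source_tangent_self p
  have hX' := (mdifferentiableAt_iff_localField hx).1 hX
  have hY' := (mdifferentiableAt_iff_localField hx).1 hY
  apply chartDeriv_injective hp
  rw [chartDeriv_mlieBracket hp (mdifferentiableAt_horizontalField hcov hX)
    (mdifferentiableAt_verticalField hY),
    lieBracket_congr (localField_horizontalField hcov p X) (localField_verticalField p Y),
    chartDeriv_verticalLift hx, extChartAt_tangent_apply hx,
    lieBracket_localHorizontal_localVertical
      (differentiableAt_localChristoffel g hx) hX' hY', nabla, chartDeriv_cov hcov hx hY',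
    localField_apply hx X]

/-- `[X^V, Y^V] = 0`. -/
lemma mlieBracket_verticalField {p : TangentBundle 𝓘(ℝ, E) M}
    {X Y : Π x : M, TangentSpace 𝓘(ℝ, E) x}
    (hX : MDifferentiableAt 𝓘(ℝ, E) 𝓘(ℝ, E).tangent
      (fun x => (⟨x, X x⟩ : TangentBundle 𝓘(ℝ, E) M)) p.1)
    (hY : MDifferentiableAt 𝓘(ℝ, E) 𝓘(ℝ, E).tangent
      (fun x => (⟨x, Y x⟩ : TangentBundle 𝓘(ℝ, E) M)) p.1) :
    VectorField.mlieBracket 𝓘(ℝ, E).tangent (verticalField X) (verticalField Y) p = 0 := by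
  have : CompleteSpace E := FiniteDimensional.complete ℝ E
  have hx := mem_chart_source E p.1
  have hp := mem_chart_source_tangent_self p
  have hX' := (mdifferentiableAt_iff_localField hx).1 hX
  have hY' := (mdifferentiableAt_iff_localField hx).1 hY
  apply chartDeriv_injective hp
  rw [chartDeriv_mlieBracket hp (mdifferentiableAt_verticalField hX)
    (mdifferentiableAt_verticalField hY),
    lieBracket_congr (localField_verticalField p X) (localField_verticalField p Y),
    extChartAt_tangent_apply hx, lieBracket_localVertical hX' hY', map_zero]

-- Chain rule for the projection `TM → M`, which is `Prod.fst` in the induced charts.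
omit [FiniteDimensional ℝ E] in
lemma mvfderiv_comp_proj {h : M → ℝ} {p : TangentBundle 𝓘(ℝ, E) M}
    (hh : MDifferentiableAt 𝓘(ℝ, E) 𝓘(ℝ, ℝ) h p.1)
    (ξ : TangentSpace 𝓘(ℝ, E).tangent p) :
    mvfderiv 𝓘(ℝ, E).tangent (fun q : TangentBundle 𝓘(ℝ, E) M => h q.1) p ξ
      = mvfderiv 𝓘(ℝ, E) h p.1 (projection p ξ) := by
  have hx := mem_chart_source E p.1
  have hp := mem_chart_source_tangent_self p
  have hd := (mdifferentiableAt_iff_comp_symm hx).1 hh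
  have hev : (fun q : TangentBundle 𝓘(ℝ, E) M => h q.1) ∘ (extChartAt 𝓘(ℝ, E).tangent p).symm
      =ᶠ[nhds (extChartAt 𝓘(ℝ, E).tangent p p)]
        fun r : E × E => (h ∘ (extChartAt 𝓘(ℝ, E) p.1).symm) r.1 := by
    refine eventually_of_forall_tangent p fun q hq hqs => ?_
    simp only [Function.comp_apply]
    rw [hqs, extChartAt_tangent_apply hq, symm_extChartAt_apply hq]
  have h1 : HasFDerivAt (fun r : E × E => (h ∘ (extChartAt 𝓘(ℝ, E) p.1).symm) r.1)
      ((fderiv ℝ (h ∘ (extChartAt 𝓘(ℝ, E) p.1).symm) (extChartAt 𝓘(ℝ, E) p.1 p.1)).comp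
        (ContinuousLinearMap.fst ℝ E E)) (extChartAt 𝓘(ℝ, E).tangent p p) := by
    rw [extChartAt_tangent_apply hx]
    exact hasFDerivAt_comp_fst (q := (_, _)) hd
  have h2 := h1.congr_of_eventuallyEq hev
  rw [mvfderiv_eq_fderiv hp ((mdifferentiableAt_iff_comp_symm hp).2 h2.differentiableAt),
    mvfderiv_eq_fderiv hx hh, h2.fderiv, chartDeriv_self, chartDeriv_self]
  rfl

end LiftedFields

/-! ### Smoothness of the gradient and symmetry of the Hessian. -/

section Gradient

variable {E : Type*} [NormedAddCommGroup E] [NormedSpace ℝ E] [FiniteDimensional ℝ E]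
  {M : Type*} [TopologicalSpace M] [ChartedSpace E M] [IsManifold 𝓘(ℝ, E) ∞ M]

/-- The gradient in the preferred chart at `x`. -/
lemma localMetric_localField_grad (g : SmoothMetric E M) {f : M → ℝ}
    (hf : ContMDiff 𝓘(ℝ, E) 𝓘(ℝ, ℝ) ∞ f) (x : M) :
    (fun z => localMetric g x z (localField 𝓘(ℝ, E) x (grad g f) z))
      =ᶠ[nhds (extChartAt 𝓘(ℝ, E) x x)] fderiv ℝ (f ∘ (extChartAt 𝓘(ℝ, E) x).symm) := by
  filter_upwards [eventually_symm_mem (I := 𝓘(ℝ, E)) (mem_chart_source E x)] with z hz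
  ext b
  have h1 := localMetric_chartDeriv g hz.1 (grad g f ((extChartAt 𝓘(ℝ, E) x).symm z))
    (constField 𝓘(ℝ, E) x b _)
  have h2 := mvfderiv_eq_fderiv (I := 𝓘(ℝ, E)) hz.1
    ((hf ((extChartAt 𝓘(ℝ, E) x).symm z)).mdifferentiableAt (by simp))
    (constField 𝓘(ℝ, E) x b _)
  rw [inner_grad, h2, chartDeriv_constField hz.1, hz.2] at h1
  exact h1

/-- In coordinates the gradient is the inverse of the metric applied to `df`, and inversion of
operators is smooth. -/
lemma contDiffAt_localField_grad (g : SmoothMetric E M) {f : M → ℝ}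
    (hf : ContMDiff 𝓘(ℝ, E) 𝓘(ℝ, ℝ) ∞ f) (x : M) :
    ContDiffAt ℝ ∞ (localField 𝓘(ℝ, E) x (grad g f)) (extChartAt 𝓘(ℝ, E) x x) := by
  have : CompleteSpace E := FiniteDimensional.complete ℝ E
  have hx := mem_chart_source E x
  have hφ : ContDiffAt ℝ ∞ (fderiv ℝ (f ∘ (extChartAt 𝓘(ℝ, E) x).symm))
      (extChartAt 𝓘(ℝ, E) x x) := (contDiffAt_comp_symm hx (hf x)).fderiv_right (by simp)
  obtain ⟨e, he⟩ := isInvertible_localMetric g (x₀ := x) (z := extChartAt 𝓘(ℝ, E) x x)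
    (by rwa [symm_extChartAt_apply hx])
  have hinv : ContDiffAt ℝ ∞ (fun z => (localMetric g x z).inverse)
      (extChartAt 𝓘(ℝ, E) x x) := by
    have h := contDiffAt_map_inverse (n := ∞) (𝕜 := ℝ) e
    rw [he] at h
    exact h.comp (extChartAt 𝓘(ℝ, E) x x) (contDiffAt_localMetric g hx)
  refine (hinv.clm_apply hφ).congr_of_eventuallyEq ?_
  filter_upwards [localMetric_localField_grad g hf x,
    eventually_symm_mem (I := 𝓘(ℝ, E)) hx] with z hz hz'
  rw [← hz]
  obtain ⟨e', he'⟩ := isInvertible_localMetric g hz'.1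
  rw [← he', ContinuousLinearMap.inverse_equiv]
  exact (e'.symm_apply_apply _).symm

lemma mdifferentiableAt_grad (g : SmoothMetric E M) {f : M → ℝ}
    (hf : ContMDiff 𝓘(ℝ, E) 𝓘(ℝ, ℝ) ∞ f) (x : M) :
    MDifferentiableAt 𝓘(ℝ, E) 𝓘(ℝ, E).tangent
      (fun y => (⟨y, grad g f y⟩ : TangentBundle 𝓘(ℝ, E) M)) x :=
  (mdifferentiableAt_iff_localField (mem_chart_source E x)).2
    ((contDiffAt_localField_grad g hf x).differentiableAt (by simp))

/-- The Hessian is symmetric. -/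
lemma inner_cov_grad_symm {g : SmoothMetric E M} {cov : Connection E M}
    (hcov : IsLeviCivita g.toRiemannianMetric cov) {f : M → ℝ}
    (hf : ContMDiff 𝓘(ℝ, E) 𝓘(ℝ, ℝ) ∞ f) (x : M) (v w : TangentSpace 𝓘(ℝ, E) x) :
    g.inner x (cov (grad g f) x v) w = g.inner x (cov (grad g f) x w) v := by
  have hx := mem_chart_source E x
  have hgr := (contDiffAt_localField_grad g hf x).differentiableAt (by simp)
  have hG := (contDiffAt_localMetric g hx).differentiableAt (by simp)
  have hφ := (contDiffAt_comp_symm hx (hf x)).isSymmSndFDerivAt (by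
    rw [minSmoothness_of_isRCLikeNormedField]
    norm_cast)
  have hcov' := chartDeriv_cov hcov hx hgr
  have hΓ := localChristoffel_symm g hx
  have hDG := fderiv_localMetric g hx
  -- Differentiating `G(grad f, ·) = df` and expressing `∂G` by Christoffel symbols gives `g(∇_a
  -- grad f, b) = D²f(a, b) - G(grad f, Γ(a, b))`, whose right side is symmetric.
  have hD := (hG.hasFDerivAt.clm_apply hgr.hasFDerivAt).fderiv
  rw [(localMetric_localField_grad g hf x).fderiv_eq] at hD
  have h1 := localMetric_chartDeriv g hx (cov (grad g f) x v) w
  have h2 := localMetric_chartDeriv g hx (cov (grad g f) x w) v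
  rw [hcov'] at h1 h2
  rw [← h1, ← h2]
  generalize chartDeriv 𝓘(ℝ, E) x x v = a
  generalize chartDeriv 𝓘(ℝ, E) x x w = b
  have key (a b : E) := congrArg (fun L : E →L[ℝ] E →L[ℝ] ℝ => L a b) hD
  have ha := key a b
  have hb := key b a
  have hs := hφ a b
  simp only [add_apply, ContinuousLinearMap.comp_apply, ContinuousLinearMap.flip_apply] at ha hb
  rw [hDG] at ha hb
  rw [hs, hb, hΓ b a] at ha
  simp only [map_add, add_apply]
  linarith

end Gradient

/-! ### The vertical form `g + df ⊗ df` and the detection of vectors by pairing. -/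

section FibreForm

variable {E : Type*} [NormedAddCommGroup E] [NormedSpace ℝ E] [FiniteDimensional ℝ E]
  {M : Type*} [TopologicalSpace M] [ChartedSpace E M] [IsManifold 𝓘(ℝ, E) ∞ M]

/-- The form `g + df ⊗ df` on `TM`, with `df = g (grad f, ·)`. -/
def fibreForm (g : SmoothMetric E M) (f : M → ℝ) (x : M) (v w : TangentSpace 𝓘(ℝ, E) x) : ℝ :=
  g.inner x v w + g.inner x (grad g f x) v * g.inner x (grad g f x) w

omit [FiniteDimensional ℝ E] in
lemma mdifferentiableAt_inner (g : SmoothMetric E M) {x : M}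
    {V W : Π x : M, TangentSpace 𝓘(ℝ, E) x}
    (hV : MDifferentiableAt 𝓘(ℝ, E) 𝓘(ℝ, E).tangent
      (fun y => (⟨y, V y⟩ : TangentBundle 𝓘(ℝ, E) M)) x)
    (hW : MDifferentiableAt 𝓘(ℝ, E) 𝓘(ℝ, E).tangent
      (fun y => (⟨y, W y⟩ : TangentBundle 𝓘(ℝ, E) M)) x) :
    MDifferentiableAt 𝓘(ℝ, E) 𝓘(ℝ, ℝ) (fun y => g.inner y (V y) (W y)) x := by
  have h := MDifferentiableAt.clm_bundle_apply₂ (F₁ := E) (F₂ := E) (F₃ := ℝ) (E₃ := fun _ : M => ℝ)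
    (b := fun x => x) (ψ := g.inner) (v := V) (w := W)
    ((g.contMDiff x).mdifferentiableAt (by simp)) hV hW
  exact (mdifferentiableAt_section (F := ℝ) (E := fun _ : M => ℝ) (IB := 𝓘(ℝ, E)) _).1 h

lemma mdifferentiableAt_fibreForm (g : SmoothMetric E M) {f : M → ℝ}
    (hf : ContMDiff 𝓘(ℝ, E) 𝓘(ℝ, ℝ) ∞ f) {x : M}
    {V W : Π x : M, TangentSpace 𝓘(ℝ, E) x}
    (hV : MDifferentiableAt 𝓘(ℝ, E) 𝓘(ℝ, E).tangent
      (fun y => (⟨y, V y⟩ : TangentBundle 𝓘(ℝ, E) M)) x)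
    (hW : MDifferentiableAt 𝓘(ℝ, E) 𝓘(ℝ, E).tangent
      (fun y => (⟨y, W y⟩ : TangentBundle 𝓘(ℝ, E) M)) x) :
    MDifferentiableAt 𝓘(ℝ, E) 𝓘(ℝ, ℝ) (fun y => fibreForm g f y (V y) (W y)) x :=
  have hgr := mdifferentiableAt_grad g hf x
  (mdifferentiableAt_inner g hV hW).add
    ((mdifferentiableAt_inner g hgr hV).mul (mdifferentiableAt_inner g hgr hW))

/-- The form is not parallel: the last two summands are its covariant derivative, caused by the
Hessian of `f`. -/
lemma mvfderiv_fibreForm {g : SmoothMetric E M} {cov : Connection E M}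
    (hcov : IsLeviCivita g.toRiemannianMetric cov) {f : M → ℝ}
    (hf : ContMDiff 𝓘(ℝ, E) 𝓘(ℝ, ℝ) ∞ f) {x : M}
    {V W : Π x : M, TangentSpace 𝓘(ℝ, E) x}
    (hV : MDifferentiableAt 𝓘(ℝ, E) 𝓘(ℝ, E).tangent
      (fun y => (⟨y, V y⟩ : TangentBundle 𝓘(ℝ, E) M)) x)
    (hW : MDifferentiableAt 𝓘(ℝ, E) 𝓘(ℝ, E).tangent
      (fun y => (⟨y, W y⟩ : TangentBundle 𝓘(ℝ, E) M)) x) (v : TangentSpace 𝓘(ℝ, E) x) :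
    mvfderiv 𝓘(ℝ, E) (fun y => fibreForm g f y (V y) (W y)) x v
      = fibreForm g f x (cov V x v) (W x) + fibreForm g f x (V x) (cov W x v)
        + g.inner x (cov (grad g f) x v) (V x) * g.inner x (grad g f x) (W x)
        + g.inner x (grad g f x) (V x) * g.inner x (cov (grad g f) x v) (W x) := by
  have hgr := mdifferentiableAt_grad g hf x
  have h1 := mdifferentiableAt_inner g hgr hV
  have h2 := mdifferentiableAt_inner g hgr hW
  have e : mvfderiv 𝓘(ℝ, E) (fun y => fibreForm g f y (V y) (W y)) x v = _ :=
    congrArg (fun L : TangentSpace 𝓘(ℝ, E) x →L[ℝ] ℝ => L v)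
      (mvfderiv_fun_add (mdifferentiableAt_inner g hV hW) (h1.mul h2))
  have e1 := congrArg (fun L : TangentSpace 𝓘(ℝ, E) x →L[ℝ] ℝ => L v) (mvfderiv_fun_mul h1 h2)
  have k0 : mvfderiv 𝓘(ℝ, E) (fun y => g.inner y (V y) (W y)) x v
    = g.inner x _ _ + g.inner x _ _ := hcov.metric V W x v hV hW
  have k1 : mvfderiv 𝓘(ℝ, E) (fun y => g.inner y (grad g f y) (V y)) x v
    = g.inner x _ _ + g.inner x _ _ := hcov.metric (grad g f) V x v hgr hV
  have k2 : mvfderiv 𝓘(ℝ, E) (fun y => g.inner y (grad g f y) (W y)) x v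
    = g.inner x _ _ + g.inner x _ _ := hcov.metric (grad g f) W x v hgr hW
  simp only [add_apply, smul_apply, smul_eq_mul] at e e1
  rw [k1, k2] at e1
  rw [e, k0]
  refine (congrArg (fun t : ℝ => _ + t) e1).trans ?_
  simp only [fibreForm]
  ring

/-- Identifies `X(α)/2` with `df(∇_X grad f)`, the correction that appears when the vertical form is
inverted. -/
lemma mvfderiv_alpha {g : SmoothMetric E M} {cov : Connection E M}
    (hcov : IsLeviCivita g.toRiemannianMetric cov) {f : M → ℝ}
    (hf : ContMDiff 𝓘(ℝ, E) 𝓘(ℝ, ℝ) ∞ f) (x : M) (v : TangentSpace 𝓘(ℝ, E) x) :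
    mvfderiv 𝓘(ℝ, E) (alpha g f) x v = 2 * g.inner x (cov (grad g f) x v) (grad g f x) := by
  have hgr := mdifferentiableAt_grad g hf x
  have e : mvfderiv 𝓘(ℝ, E) (alpha g f) x v = _ :=
    congrArg (fun L : TangentSpace 𝓘(ℝ, E) x →L[ℝ] ℝ => L v)
      (mvfderiv_fun_add (mdifferentiableAt_const (c := (1 : ℝ)))
        (mdifferentiableAt_inner g hgr hgr))
  have k0 : mvfderiv 𝓘(ℝ, E) (fun y => g.inner y (grad g f y) (grad g f y)) x v
    = g.inner x _ _ + g.inner x _ _ := hcov.metric (grad g f) (grad g f) x v hgr hgr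
  rw [g.symm x (grad g f x)] at k0
  rw [e, mvfderiv_const, zero_add, k0]
  ring

omit [FiniteDimensional ℝ E] in
lemma eq_of_inner_eq (g : SmoothMetric E M) {x : M} {v w : TangentSpace 𝓘(ℝ, E) x}
    (h : ∀ z, g.inner x v z = g.inner x w z) : v = w :=
  flat_injective g x (LinearMap.ext h)

/-- Nondegeneracy follows from positivity: the rank-one term `df ⊗ df` is nonnegative on the
diagonal. -/
lemma eq_of_fibreForm_eq (g : SmoothMetric E M) (f : M → ℝ) {x : M}
    {v w : TangentSpace 𝓘(ℝ, E) x} (h : ∀ z, fibreForm g f x v z = fibreForm g f x w z) :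
    v = w := by
  by_contra hne
  have h1 := h (v - w)
  have h2 := g.pos x (v - w) (sub_ne_zero.2 hne)
  have h3 := mul_self_nonneg (g.inner x (grad g f x) (v - w))
  simp only [fibreForm, map_sub, sub_apply] at h1 h2 h3
  linarith

lemma musGradientMetric_horizontalLift (g : SmoothMetric E M) (f : M → ℝ) (cov : Connection E M)
    (p : TangentBundle 𝓘(ℝ, E) M) (ξ : TangentSpace 𝓘(ℝ, E).tangent p)
    (z : TangentSpace 𝓘(ℝ, E) p.1) :
    (musGradientMetric g f cov).inner p ξ (horizontalLift cov p z)
      = g.inner p.1 (projection p ξ) z := by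
  simp [musGradientMetric, musGradientForm_apply]

lemma musGradientMetric_verticalLift (g : SmoothMetric E M) (f : M → ℝ) (cov : Connection E M)
    (p : TangentBundle 𝓘(ℝ, E) M) (ξ : TangentSpace 𝓘(ℝ, E).tangent p)
    (z : TangentSpace 𝓘(ℝ, E) p.1) :
    (musGradientMetric g f cov).inner p ξ (verticalLift p z)
      = fibreForm g f p.1 (verticalPart cov p ξ) z := by
  simp [musGradientMetric, musGradientForm_apply, fibreForm, inner_grad]

omit [FiniteDimensional ℝ E] in
lemma eq_of_parts (cov : Connection E M) (p : TangentBundle 𝓘(ℝ, E) M)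
    {ξ η : TangentSpace 𝓘(ℝ, E).tangent p} (h₁ : projection p ξ = projection p η)
    (h₂ : verticalPart cov p ξ = verticalPart cov p η) : ξ = η :=
  sub_eq_zero.1 (eq_zero_of_parts cov p _ (by rw [map_sub, h₁, sub_self])
    (by rw [map_sub, h₂, sub_self]))

end FibreForm

/-! ### Derivatives of the `g^f`-products of lifted fields. -/

section LiftDerivatives

variable {E : Type*} [NormedAddCommGroup E] [NormedSpace ℝ E] [FiniteDimensional ℝ E]
  {M : Type*} [TopologicalSpace M] [ChartedSpace E M] [IsManifold 𝓘(ℝ, E) ∞ M]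
  (g : SmoothMetric E M) (f : M → ℝ) (cov : Connection E M)

/-- The product is constant on fibres, so only the projection of `ξ` matters; in particular the
derivative along a vertical vector is zero. -/
lemma mvfderiv_horizontal_horizontal {V W : Π x : M, TangentSpace 𝓘(ℝ, E) x}
    {p : TangentBundle 𝓘(ℝ, E) M}
    (hV : MDifferentiableAt 𝓘(ℝ, E) 𝓘(ℝ, E).tangent
      (fun y => (⟨y, V y⟩ : TangentBundle 𝓘(ℝ, E) M)) p.1)
    (hW : MDifferentiableAt 𝓘(ℝ, E) 𝓘(ℝ, E).tangent
      (fun y => (⟨y, W y⟩ : TangentBundle 𝓘(ℝ, E) M)) p.1)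
    (ξ : TangentSpace 𝓘(ℝ, E).tangent p) :
    mvfderiv 𝓘(ℝ, E).tangent (fun q => (musGradientMetric g f cov).inner q
        (horizontalField cov V q) (horizontalField cov W q)) p ξ
      = mvfderiv 𝓘(ℝ, E) (fun x => g.inner x (V x) (W x)) p.1 (projection p ξ) := by
  rw [← mvfderiv_comp_proj (mdifferentiableAt_inner g hV hW)]
  congr 2
  funext q
  exact musGradientMetric_horizontal_horizontal g f cov q _ _

lemma mvfderiv_vertical_vertical {f : M → ℝ} (hf : ContMDiff 𝓘(ℝ, E) 𝓘(ℝ, ℝ) ∞ f)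
    {V W : Π x : M, TangentSpace 𝓘(ℝ, E) x} {p : TangentBundle 𝓘(ℝ, E) M}
    (hV : MDifferentiableAt 𝓘(ℝ, E) 𝓘(ℝ, E).tangent
      (fun y => (⟨y, V y⟩ : TangentBundle 𝓘(ℝ, E) M)) p.1)
    (hW : MDifferentiableAt 𝓘(ℝ, E) 𝓘(ℝ, E).tangent
      (fun y => (⟨y, W y⟩ : TangentBundle 𝓘(ℝ, E) M)) p.1)
    (ξ : TangentSpace 𝓘(ℝ, E).tangent p) :
    mvfderiv 𝓘(ℝ, E).tangent (fun q => (musGradientMetric g f cov).inner q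
        (verticalField V q) (verticalField W q)) p ξ
      = mvfderiv 𝓘(ℝ, E) (fun x => fibreForm g f x (V x) (W x)) p.1 (projection p ξ) := by
  rw [← mvfderiv_comp_proj (mdifferentiableAt_fibreForm g hf hV hW)]
  congr 2
  funext q
  refine (musGradientMetric_verticalLift g f cov q _ _).trans ?_
  rw [verticalField, verticalPart_verticalLift]

lemma mvfderiv_horizontal_vertical (V W : Π x : M, TangentSpace 𝓘(ℝ, E) x)
    (p : TangentBundle 𝓘(ℝ, E) M) (ξ : TangentSpace 𝓘(ℝ, E).tangent p) :
    mvfderiv 𝓘(ℝ, E).tangent (fun q => (musGradientMetric g f cov).inner q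
        (horizontalField cov V q) (verticalField W q)) p ξ = 0 := by
  have h : (fun q => (musGradientMetric g f cov).inner q
      (horizontalField cov V q) (verticalField W q)) = fun _ => (0 : ℝ) :=
    funext fun q => musGradientMetric_horizontal_vertical g f cov q _ _
  rw [h, mvfderiv_const, zero_apply]

lemma mvfderiv_vertical_horizontal (V W : Π x : M, TangentSpace 𝓘(ℝ, E) x)
    (p : TangentBundle 𝓘(ℝ, E) M) (ξ : TangentSpace 𝓘(ℝ, E).tangent p) :
    mvfderiv 𝓘(ℝ, E).tangent (fun q => (musGradientMetric g f cov).inner q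
        (verticalField V q) (horizontalField cov W q)) p ξ = 0 := by
  have h : (fun q => (musGradientMetric g f cov).inner q
      (verticalField V q) (horizontalField cov W q)) = fun _ => (0 : ℝ) :=
    funext fun q => ((musGradientMetric g f cov).symm q _ _).trans
      (musGradientMetric_horizontal_vertical g f cov q _ _)
  rw [h, mvfderiv_const, zero_apply]

end LiftDerivatives

/-! ### The Koszul formula of `g^f` evaluated on lifts. -/

section LeviCivitaTM

variable {E : Type*} [NormedAddCommGroup E] [NormedSpace ℝ E] [FiniteDimensional ℝ E]
  {M : Type*} [TopologicalSpace M] [ChartedSpace E M] [IsManifold 𝓘(ℝ, E) ∞ M]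

omit [FiniteDimensional ℝ E] in
/-- Every tangent vector is the value of a vector field that is differentiable at the point. -/
lemma exists_field (x : M) (z : TangentSpace 𝓘(ℝ, E) x) :
    ∃ Z : Π y : M, TangentSpace 𝓘(ℝ, E) y, Z x = z ∧
      MDifferentiableAt 𝓘(ℝ, E) 𝓘(ℝ, E).tangent
        (fun y => (⟨y, Z y⟩ : TangentBundle 𝓘(ℝ, E) M)) x :=
  ⟨FiberBundle.extend E z, FiberBundle.extend_apply_self E z,
    FiberBundle.mdifferentiableAt_extend 𝓘(ℝ, E) E z⟩

variable {g : SmoothMetric E M} {f : M → ℝ} {cov : Connection E M} {covf : ConnectionTM E M}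
  {X Y : Π x : M, TangentSpace 𝓘(ℝ, E) x} {p : TangentBundle 𝓘(ℝ, E) M}

/-- On three horizontal lifts the Koszul formula reduces to that of `g`: the vertical curvature
parts of the brackets are orthogonal to horizontal lifts. -/
lemma projection_nabla_horizontal_horizontal
    (hcov : IsLeviCivita g.toRiemannianMetric cov)
    (hcovf : IsLeviCivita (musGradientMetric g f cov) covf)
    (hX : MDifferentiableAt 𝓘(ℝ, E) 𝓘(ℝ, E).tangent
      (fun y => (⟨y, X y⟩ : TangentBundle 𝓘(ℝ, E) M)) p.1)
    (hY : MDifferentiableAt 𝓘(ℝ, E) 𝓘(ℝ, E).tangent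
      (fun y => (⟨y, Y y⟩ : TangentBundle 𝓘(ℝ, E) M)) p.1) :
    projection p (nabla covf (horizontalField cov X) (horizontalField cov Y) p)
      = nabla cov X Y p.1 := by
  refine eq_of_inner_eq g fun z => ?_
  obtain ⟨Z, rfl, hZ⟩ := exists_field p.1 z
  have hb : 2 * g.inner p.1 (cov Y p.1 (X p.1)) (Z p.1)
      = mvfderiv 𝓘(ℝ, E) (fun y => g.inner y (Y y) (Z y)) p.1 (X p.1)
        + mvfderiv 𝓘(ℝ, E) (fun y => g.inner y (X y) (Z y)) p.1 (Y p.1)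
        - mvfderiv 𝓘(ℝ, E) (fun y => g.inner y (X y) (Y y)) p.1 (Z p.1)
        + g.inner p.1 (VectorField.mlieBracket 𝓘(ℝ, E) X Y p.1) (Z p.1)
        - g.inner p.1 (VectorField.mlieBracket 𝓘(ℝ, E) X Z p.1) (Y p.1)
        - g.inner p.1 (VectorField.mlieBracket 𝓘(ℝ, E) Y Z p.1) (X p.1) := hcov.koszul hX hY hZ
  have hk := hcovf.koszul (mdifferentiableAt_horizontalField hcov hX)
    (mdifferentiableAt_horizontalField hcov hY) (mdifferentiableAt_horizontalField hcov hZ)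
  change 2 * (musGradientMetric g f cov).inner p
    (nabla covf (horizontalField cov X) (horizontalField cov Y) p) _ = _ at hk
  -- The unknown is made opaque so that unfolding the lifts later acts only on the other terms.
  generalize nabla covf (horizontalField cov X) (horizontalField cov Y) p = ξ at hk ⊢
  rw [mvfderiv_horizontal_horizontal g f cov hY hZ, mvfderiv_horizontal_horizontal g f cov hX hZ,
    mvfderiv_horizontal_horizontal g f cov hX hY, mlieBracket_horizontalField hcov hX hY,
    mlieBracket_horizontalField hcov hX hZ, mlieBracket_horizontalField hcov hY hZ] at hk
  simp only [horizontalField, musGradientMetric_horizontalLift, projection_horizontalLift,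
    projection_verticalLift, map_sub, sub_apply, map_zero, zero_apply, sub_zero] at hk
  rw [nabla]
  linarith

/-- Only the vertical part `-(R(X, Y)u)^V` of `[X^H, Y^H]` contributes: the remaining brackets are
vertical and paired with horizontal lifts, and `g(X, Y)` is constant along `Z^V`. -/
lemma verticalPart_nabla_horizontal_horizontal
    (hcov : IsLeviCivita g.toRiemannianMetric cov)
    (hcovf : IsLeviCivita (musGradientMetric g f cov) covf)
    (hX : MDifferentiableAt 𝓘(ℝ, E) 𝓘(ℝ, E).tangent
      (fun y => (⟨y, X y⟩ : TangentBundle 𝓘(ℝ, E) M)) p.1)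
    (hY : MDifferentiableAt 𝓘(ℝ, E) 𝓘(ℝ, E).tangent
      (fun y => (⟨y, Y y⟩ : TangentBundle 𝓘(ℝ, E) M)) p.1) :
    verticalPart cov p (nabla covf (horizontalField cov X) (horizontalField cov Y) p)
      = -((1 / 2 : ℝ) • curvature cov p.1 (X p.1) (Y p.1) p.2) := by
  refine eq_of_fibreForm_eq g f fun z => ?_
  obtain ⟨Z, rfl, hZ⟩ := exists_field p.1 z
  have hk := hcovf.koszul (mdifferentiableAt_horizontalField hcov hX)
    (mdifferentiableAt_horizontalField hcov hY) (mdifferentiableAt_verticalField hZ)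
  change 2 * (musGradientMetric g f cov).inner p
    (nabla covf (horizontalField cov X) (horizontalField cov Y) p) _ = _ at hk
  generalize nabla covf (horizontalField cov X) (horizontalField cov Y) p = ξ at hk ⊢
  rw [mvfderiv_horizontal_vertical, mvfderiv_horizontal_vertical,
    mvfderiv_horizontal_horizontal g f cov hX hY, mlieBracket_horizontalField hcov hX hY,
    mlieBracket_horizontalField_verticalField hcov hX hZ,
    mlieBracket_horizontalField_verticalField hcov hY hZ] at hk
  simp only [horizontalField, verticalField, musGradientMetric_horizontalLift,
    musGradientMetric_verticalLift, projection_verticalLift, verticalPart_verticalLift,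
    verticalPart_horizontalLift, map_sub, sub_apply, map_zero, zero_apply, fibreForm] at hk
  simp only [fibreForm, map_neg, map_smul, neg_apply, smul_apply, smul_eq_mul]
  linarith

/-- Only `[X^H, Z^H]` paired with `Y^V` survives. The two summands of the vertical form give the two
curvature terms, once pair symmetry has freed `Z`. -/
lemma projection_nabla_horizontal_vertical
    (hcov : IsLeviCivita g.toRiemannianMetric cov)
    (hcovf : IsLeviCivita (musGradientMetric g f cov) covf)
    (hX : MDifferentiableAt 𝓘(ℝ, E) 𝓘(ℝ, E).tangent
      (fun y => (⟨y, X y⟩ : TangentBundle 𝓘(ℝ, E) M)) p.1)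
    (hY : MDifferentiableAt 𝓘(ℝ, E) 𝓘(ℝ, E).tangent
      (fun y => (⟨y, Y y⟩ : TangentBundle 𝓘(ℝ, E) M)) p.1) :
    projection p (nabla covf (horizontalField cov X) (verticalField Y) p)
      = (1 / 2 : ℝ) • curvature cov p.1 p.2 (Y p.1) (X p.1)
        + (1 / 2 * lieDeriv Y f p.1) • curvature cov p.1 p.2 (grad g f p.1) (X p.1) := by
  refine eq_of_inner_eq g fun z => ?_
  obtain ⟨Z, rfl, hZ⟩ := exists_field p.1 z
  have hk := hcovf.koszul (mdifferentiableAt_horizontalField hcov hX)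
    (mdifferentiableAt_verticalField hY) (mdifferentiableAt_horizontalField hcov hZ)
  change 2 * (musGradientMetric g f cov).inner p
    (nabla covf (horizontalField cov X) (verticalField Y) p) _ = _ at hk
  generalize nabla covf (horizontalField cov X) (verticalField Y) p = ξ at hk ⊢
  rw [mvfderiv_vertical_horizontal, mvfderiv_horizontal_horizontal g f cov hX hZ,
    mvfderiv_horizontal_vertical, mlieBracket_horizontalField hcov hX hZ,
    mlieBracket_horizontalField_verticalField hcov hX hY,
    VectorField.mlieBracket_swap_apply (V := verticalField Y),
    mlieBracket_horizontalField_verticalField hcov hZ hY] at hk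
  have h1 := curvature_pair_symm hcov p.1 (X p.1) (Z p.1) p.2 (Y p.1)
  have h2 := curvature_pair_symm hcov p.1 (X p.1) (Z p.1) p.2 (grad g f p.1)
  rw [g.symm p.1 _ (grad g f p.1)] at h2
  simp only [horizontalField, verticalField, musGradientMetric_horizontalLift,
    musGradientMetric_verticalLift, projection_verticalLift, verticalPart_verticalLift,
    verticalPart_horizontalLift, map_sub, sub_apply, map_zero, zero_apply, fibreForm, map_neg,
    neg_apply, h1, h2] at hk
  simp only [map_add, map_smul, add_apply, smul_apply, smul_eq_mul, lieDeriv, ← inner_grad g f]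
  linarith

/-- With `F` the vertical form and `w` the vertical part, Koszul gives `2F(w, Z) = 2F(∇_X Y, Z) +
g(∇_X grad f, Y) Z(f) + Y(f) g(∇_X grad f, Z)`. Both covectors on the right are represented through
`F` by means of `F(grad f, ·) = α df`, which produces the factor `1/(2α)`. -/
lemma verticalPart_nabla_horizontal_vertical
    (hcov : IsLeviCivita g.toRiemannianMetric cov)
    (hcovf : IsLeviCivita (musGradientMetric g f cov) covf)
    (hf : ContMDiff 𝓘(ℝ, E) 𝓘(ℝ, ℝ) ∞ f)
    (hX : MDifferentiableAt 𝓘(ℝ, E) 𝓘(ℝ, E).tangent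
      (fun y => (⟨y, X y⟩ : TangentBundle 𝓘(ℝ, E) M)) p.1)
    (hY : MDifferentiableAt 𝓘(ℝ, E) 𝓘(ℝ, E).tangent
      (fun y => (⟨y, Y y⟩ : TangentBundle 𝓘(ℝ, E) M)) p.1) :
    verticalPart cov p (nabla covf (horizontalField cov X) (verticalField Y) p)
      = (1 / 2 * lieDeriv Y f p.1) • nabla cov X (grad g f) p.1 + nabla cov X Y p.1
        + (1 / (2 * alpha g f p.1) *
            (g.inner p.1 (Y p.1) (nabla cov X (grad g f) p.1)
              - 1 / 2 * lieDeriv X (alpha g f) p.1 * lieDeriv Y f p.1)) • grad g f p.1 := by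
  refine eq_of_fibreForm_eq g f fun z => ?_
  obtain ⟨Z, rfl, hZ⟩ := exists_field p.1 z
  have hk := hcovf.koszul (mdifferentiableAt_horizontalField hcov hX)
    (mdifferentiableAt_verticalField hY) (mdifferentiableAt_verticalField hZ)
  change 2 * (musGradientMetric g f cov).inner p
    (nabla covf (horizontalField cov X) (verticalField Y) p) _ = _ at hk
  generalize nabla covf (horizontalField cov X) (verticalField Y) p = ξ at hk ⊢
  rw [mvfderiv_vertical_vertical g cov hf hY hZ, mvfderiv_horizontal_vertical,
    mvfderiv_horizontal_vertical, mlieBracket_horizontalField_verticalField hcov hX hY,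
    mlieBracket_horizontalField_verticalField hcov hX hZ,
    mlieBracket_verticalField hY hZ] at hk
  simp only [horizontalField, verticalField, musGradientMetric_verticalLift,
    projection_horizontalLift, verticalPart_verticalLift, map_zero, zero_apply] at hk
  rw [mvfderiv_fibreForm hcov hf hY hZ] at hk
  have hα : 0 < alpha g f p.1 :=
    add_pos_of_pos_of_nonneg one_pos (inner_self_nonneg g p.1 (grad g f p.1))
  have hs1 := g.symm p.1 (cov Z p.1 (X p.1)) (Y p.1)
  have hs2 := g.symm p.1 (cov (grad g f) p.1 (X p.1)) (Y p.1)
  have hs3 := g.symm p.1 (cov (grad g f) p.1 (X p.1)) (grad g f p.1)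
  simp only [map_add, map_smul, add_apply, smul_apply, smul_eq_mul, lieDeriv, ← inner_grad g f,
    fibreForm, mvfderiv_alpha hcov hf, nabla] at hk ⊢
  -- Eliminating `|grad f|²` in favour of `α` lets the denominator cancel.
  have hα' : g.inner p.1 (grad g f p.1) (grad g f p.1) = alpha g f p.1 - 1 := by
    rw [alpha]
    ring
  rw [hs1, hs2] at hk
  rw [hα', hs3]
  generalize alpha g f p.1 = α at *
  field_simp
  linear_combination α * hk

/-- The surviving Koszul terms form minus the covariant derivative along `Z` of the vertical form on
`(X, Y)`. Symmetry of the Hessian then moves `Z` out of the differentiation slot. -/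
lemma projection_nabla_vertical_vertical
    (hcov : IsLeviCivita g.toRiemannianMetric cov)
    (hcovf : IsLeviCivita (musGradientMetric g f cov) covf)
    (hf : ContMDiff 𝓘(ℝ, E) 𝓘(ℝ, ℝ) ∞ f)
    (hX : MDifferentiableAt 𝓘(ℝ, E) 𝓘(ℝ, E).tangent
      (fun y => (⟨y, X y⟩ : TangentBundle 𝓘(ℝ, E) M)) p.1)
    (hY : MDifferentiableAt 𝓘(ℝ, E) 𝓘(ℝ, E).tangent
      (fun y => (⟨y, Y y⟩ : TangentBundle 𝓘(ℝ, E) M)) p.1) :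
    projection p (nabla covf (verticalField X) (verticalField Y) p)
      = -((1 / 2 * lieDeriv X f p.1) • nabla cov Y (grad g f) p.1)
        - (1 / 2 * lieDeriv Y f p.1) • nabla cov X (grad g f) p.1 := by
  refine eq_of_inner_eq g fun z => ?_
  obtain ⟨Z, rfl, hZ⟩ := exists_field p.1 z
  have hk := hcovf.koszul (mdifferentiableAt_verticalField hX)
    (mdifferentiableAt_verticalField hY) (mdifferentiableAt_horizontalField hcov hZ)
  change 2 * (musGradientMetric g f cov).inner p
    (nabla covf (verticalField X) (verticalField Y) p) _ = _ at hk
  generalize nabla covf (verticalField X) (verticalField Y) p = ξ at hk ⊢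
  rw [mvfderiv_vertical_horizontal, mvfderiv_vertical_horizontal,
    mvfderiv_vertical_vertical g cov hf hX hY, mlieBracket_verticalField hX hY,
    VectorField.mlieBracket_swap_apply (V := verticalField X),
    mlieBracket_horizontalField_verticalField hcov hZ hX,
    VectorField.mlieBracket_swap_apply (V := verticalField Y),
    mlieBracket_horizontalField_verticalField hcov hZ hY] at hk
  simp only [horizontalField, verticalField, musGradientMetric_horizontalLift,
    musGradientMetric_verticalLift, projection_horizontalLift, verticalPart_verticalLift,
    map_zero, zero_apply, map_neg, neg_apply] at hk
  rw [mvfderiv_fibreForm hcov hf hX hY] at hk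
  have hs1 := g.symm p.1 (cov Y p.1 (Z p.1)) (X p.1)
  have hs2 := inner_cov_grad_symm hcov hf p.1 (Z p.1) (X p.1)
  have hs3 := inner_cov_grad_symm hcov hf p.1 (Z p.1) (Y p.1)
  simp only [map_sub, map_neg, map_smul, sub_apply, neg_apply, smul_apply, smul_eq_mul, lieDeriv,
    ← inner_grad g f, fibreForm, nabla] at hk ⊢
  rw [hs1, hs2, hs3] at hk
  linarith

/-- On each fibre the metric is translation invariant and vertical lifts are constant fields, so
every term of the Koszul formula vanishes. -/
lemma verticalPart_nabla_vertical_vertical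
    (hcovf : IsLeviCivita (musGradientMetric g f cov) covf)
    (hf : ContMDiff 𝓘(ℝ, E) 𝓘(ℝ, ℝ) ∞ f)
    (hX : MDifferentiableAt 𝓘(ℝ, E) 𝓘(ℝ, E).tangent
      (fun y => (⟨y, X y⟩ : TangentBundle 𝓘(ℝ, E) M)) p.1)
    (hY : MDifferentiableAt 𝓘(ℝ, E) 𝓘(ℝ, E).tangent
      (fun y => (⟨y, Y y⟩ : TangentBundle 𝓘(ℝ, E) M)) p.1) :
    verticalPart cov p (nabla covf (verticalField X) (verticalField Y) p) = 0 := by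
  refine eq_of_fibreForm_eq g f fun z => ?_
  obtain ⟨Z, rfl, hZ⟩ := exists_field p.1 z
  have hk := hcovf.koszul (mdifferentiableAt_verticalField hX)
    (mdifferentiableAt_verticalField hY) (mdifferentiableAt_verticalField hZ)
  change 2 * (musGradientMetric g f cov).inner p
    (nabla covf (verticalField X) (verticalField Y) p) _ = _ at hk
  generalize nabla covf (verticalField X) (verticalField Y) p = ξ at hk ⊢
  rw [mvfderiv_vertical_vertical g cov hf hY hZ, mvfderiv_vertical_vertical g cov hf hX hZ,
    mvfderiv_vertical_vertical g cov hf hX hY, mlieBracket_verticalField hX hY,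
    mlieBracket_verticalField hX hZ, mlieBracket_verticalField hY hZ] at hk
  simp only [verticalField, musGradientMetric_verticalLift, projection_verticalLift,
    map_zero, zero_apply] at hk
  simp only [fibreForm, map_zero, zero_apply] at hk ⊢
  linarith

/-- `∇_{X^V} Y^H = ∇_{Y^H} X^V - (∇_Y X)^V`. -/
lemma nabla_vertical_horizontal
    (hcov : IsLeviCivita g.toRiemannianMetric cov)
    (hcovf : IsLeviCivita (musGradientMetric g f cov) covf)
    (hX : MDifferentiableAt 𝓘(ℝ, E) 𝓘(ℝ, E).tangent
      (fun y => (⟨y, X y⟩ : TangentBundle 𝓘(ℝ, E) M)) p.1)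
    (hY : MDifferentiableAt 𝓘(ℝ, E) 𝓘(ℝ, E).tangent
      (fun y => (⟨y, Y y⟩ : TangentBundle 𝓘(ℝ, E) M)) p.1) :
    nabla covf (verticalField X) (horizontalField cov Y) p
      = nabla covf (horizontalField cov Y) (verticalField X) p
        - verticalLift p (nabla cov Y X p.1) := by
  have h := hcovf.torsion_free _ _ p (mdifferentiableAt_horizontalField hcov hY)
    (mdifferentiableAt_verticalField hX)
  rw [mlieBracket_horizontalField_verticalField hcov hY hX] at h
  rw [← h, nabla, nabla, sub_sub_cancel]

end LeviCivitaTM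

end MusGradient

end

theorem theorem3 {E : Type*} [NormedAddCommGroup E] [NormedSpace ℝ E] [FiniteDimensional ℝ E]
    {M : Type*} [TopologicalSpace M] [ChartedSpace E M] [IsManifold 𝓘(ℝ, E) ∞ M]
    (g : SmoothMetric E M)
    (f : M → ℝ) (hf : ContMDiff 𝓘(ℝ, E) 𝓘(ℝ, ℝ) ∞ f) (hf_pos : ∀ x, 0 < f x)
    -- the Levi-Civita connection of `(M, g)`
    (cov : Connection E M) (hcov : IsLeviCivita g.toRiemannianMetric cov)
    -- the Levi-Civita connection of `(TM, g^f)`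
    (covf : ConnectionTM E M) (hcovf : IsLeviCivita (musGradientMetric g f cov) covf)
    -- smooth vector fields on `M`
    (X Y : Π x : M, TangentSpace 𝓘(ℝ, E) x)
    (hX : ContMDiff 𝓘(ℝ, E) 𝓘(ℝ, E).tangent ∞ (fun x => (⟨x, X x⟩ : TangentBundle 𝓘(ℝ, E) M)))
    (hY : ContMDiff 𝓘(ℝ, E) 𝓘(ℝ, E).tangent ∞ (fun x => (⟨x, Y x⟩ : TangentBundle 𝓘(ℝ, E) M)))
    -- a point `p = (x, u)` of `TM`; here `x = p.1` and `u = p.2`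
    (p : TangentBundle 𝓘(ℝ, E) M) :
    (nabla covf (horizontalField cov X) (horizontalField cov Y) p
        = horizontalLift cov p (nabla cov X Y p.1)
          - (1 / 2 : ℝ) • verticalLift p (curvature cov p.1 (X p.1) (Y p.1) p.2)) ∧
    (nabla covf (horizontalField cov X) (verticalField Y) p
        = (1 / 2 : ℝ) • horizontalLift cov p (curvature cov p.1 p.2 (Y p.1) (X p.1))
          + (1 / 2 * lieDeriv Y f p.1) •
              horizontalLift cov p (curvature cov p.1 p.2 (grad g f p.1) (X p.1))
          + (1 / 2 * lieDeriv Y f p.1) • verticalLift p (nabla cov X (grad g f) p.1)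
          + verticalLift p (nabla cov X Y p.1)
          + (1 / (2 * alpha g f p.1) *
              (g.inner p.1 (Y p.1) (nabla cov X (grad g f) p.1)
                - 1 / 2 * lieDeriv X (alpha g f) p.1 * lieDeriv Y f p.1)) •
              verticalLift p (grad g f p.1)) ∧
    (nabla covf (verticalField X) (horizontalField cov Y) p
        = (1 / 2 : ℝ) • horizontalLift cov p (curvature cov p.1 p.2 (X p.1) (Y p.1))
          + (1 / 2 * lieDeriv X f p.1) •
              horizontalLift cov p (curvature cov p.1 p.2 (grad g f p.1) (Y p.1))
          + (1 / 2 * lieDeriv X f p.1) • verticalLift p (nabla cov Y (grad g f) p.1)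
          + (1 / (2 * alpha g f p.1) *
              (g.inner p.1 (X p.1) (nabla cov Y (grad g f) p.1)
                - 1 / 2 * lieDeriv Y (alpha g f) p.1 * lieDeriv X f p.1)) •
              verticalLift p (grad g f p.1)) ∧
    (nabla covf (verticalField X) (verticalField Y) p
        = -((1 / 2 * lieDeriv X f p.1) • horizontalLift cov p (nabla cov Y (grad g f) p.1))
          - (1 / 2 * lieDeriv Y f p.1) • horizontalLift cov p (nabla cov X (grad g f) p.1)) := by
  have hXp := (hX p.1).mdifferentiableAt (by simp)
  have hYp := (hY p.1).mdifferentiableAt (by simp)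
  refine ⟨eq_of_parts cov p ?_ ?_, eq_of_parts cov p ?_ ?_, eq_of_parts cov p ?_ ?_,
    eq_of_parts cov p ?_ ?_⟩
  · rw [projection_nabla_horizontal_horizontal hcov hcovf hXp hYp]
    simp
  · rw [verticalPart_nabla_horizontal_horizontal hcov hcovf hXp hYp]
    simp
  · rw [projection_nabla_horizontal_vertical hcov hcovf hXp hYp]
    simp
  · rw [verticalPart_nabla_horizontal_vertical hcov hcovf hf hXp hYp]
    simp
  -- Vanishing torsion reduces the third formula to the second with `X` and `Y` exchanged; the
  -- correction `(∇_Y X)^V` has no horizontal part.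
  · rw [nabla_vertical_horizontal hcov hcovf hXp hYp, map_sub,
      projection_nabla_horizontal_vertical hcov hcovf hYp hXp]
    simp
  -- Here the correction cancels the term `(∇_Y X)^V` of the second formula, which is why the third
  -- has none.
  · rw [nabla_vertical_horizontal hcov hcovf hXp hYp, map_sub,
      verticalPart_nabla_horizontal_vertical hcov hcovf hf hYp hXp]
    simp only [map_add, map_smul, verticalPart_verticalLift, verticalPart_horizontalLift]
    module
  · rw [projection_nabla_vertical_vertical hcov hcovf hf hXp hYp]
    simp
  · rw [verticalPart_nabla_vertical_vertical hcovf hf hXp hYp]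
    simp
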